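/- **Proposition.** Let $r\ge 1$ and let $n_1,\dots,n_r$ be positive integers. For each $i$ let the symmetric group $\mathfrak S_{n_i}$ act on $\mathbb Q^{n_i}$ by permuting the standard basis vectors $\varepsilon_{1,i},\dots,\varepsilon_{n_i,i}$, and let $$Q_i=\Big\{x\in\mathbb Z^{n_i}\ \Big|\ \sum_j x_j=0\Big\},\qquad P_i=\Big\{x\in\mathbb Q^{n_i}\ \Big|\ \sum_j x_j=0,\ x_j-x_k\in\mathbb Z\text{ for all }j,k\Big\}$$ be the root lattice and the weight lattice of $\mathrm{SL}_{n_i}$. The group $P_i/Q_i$ is identified with $\mathbb Z/n_i\mathbb Z$ by letting the class of $\omega_i=\varepsilon_{1,i}-\frac1{n_i}\sum_j\varepsilon_{j,i}$ correspond to $1$. Put $$Q=\bigoplus_i Q_i,\qquad P=\bigoplus_i P_i,\qquad F=P/Q=\bigoplus_i \mathbb Z/n_i\mathbb Z,\qquad W=\prod_i\mathfrak S_{n_i};$$ the group $W$ acts on $Q$ and $P$, and trivially on $F$. Let $d>1$ be a divisor of $\gcd(n_1,\dots,n_r)$, and let $\nu_1,\dots,\nu_r$ be integers with $1\le\nu_i<d$,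 $\gcd(\nu_i,d)=1$ for all $i$, and $\nu_1=1$. Let $S_\nu\subset(\mathbb Z/d\mathbb Z)^r\subset\bigoplus_i\mathbb Z/n_i\mathbb Z=F$ be the cyclic subgroup generated by the image of $\nu=(\nu_1,\dots,\nu_r)$, where $\mathbb Z/d\mathbb Z$ is embedded in $\mathbb Z/n_i\mathbb Z$ by $1\mapsto n_i/d$. Let $L_\nu$ be the preimage of $S_\nu$ in $P$; it is a $W$-lattice with $Q\subset L_\nu\subset P$. Assume that $\sum_i n_i>4$ if $d$ is a power of $2$, and that $\sum_i n_i\neq 3$ (that is, we exclude the case $r=1$, $n_1=d=3$). Then $L_\nu$ is not a quasi-permutation $W$-lattice: there is no short exact sequence of $W$-lattices $$0\to L_\nu\to E\to E'\to 0$$ in which $E$ and $E'$ are permutation lattices, i.e. have finite $\mathbb Z$-bases permuted by $W$. -/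

import Mathlib

open scoped BigOperators

/-- A `ℤ`-linear representation of `Γ` on `M` is a permutation lattice if `M` has a finite
`ℤ`-basis which is permuted by `Γ`. -/
def IsPermutationLattice {Γ M : Type*} [Group Γ] [AddCommGroup M]
    (ρ : Representation ℤ Γ M) : Prop :=
  ∃ (k : ℕ) (b : Module.Basis (Fin k) ℤ M), ∀ g : Γ, ∀ i, ∃ j, ρ g (b i) = b j

/-- A `Γ`-lattice `L` is quasi-permutation if there is a short exact sequence of `Γ`-lattices
`0 → L → P → P' → 0` in which `P` and `P'` are permutation lattices. (A permutation lattice is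
finitely generated, so it loses nothing to take `P` and `P'` in the lowest universe.) -/
def IsQuasiPermutationLattice {Γ L : Type*} [Group Γ] [AddCommGroup L]
    (ρ : Representation ℤ Γ L) : Prop :=
  ∃ (P P' : Type) (_ : AddCommGroup P) (_ : AddCommGroup P')
    (σ : Representation ℤ Γ P) (σ' : Representation ℤ Γ P')
    (f : ρ.IntertwiningMap σ) (g : σ.IntertwiningMap σ'),
    IsPermutationLattice σ ∧ IsPermutationLattice σ' ∧
      Function.Injective f.toLinearMap ∧
      Function.Exact f.toLinearMap g.toLinearMap ∧
      Function.Surjective g.toLinearMap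

namespace TypeA

/-- The root lattice of `SL_m`: integral vectors in `ℚ^m` with zero sum of the coordinates. -/
def rootLattice (m : ℕ) : Submodule ℤ (Fin m → ℚ) where
  carrier := {x | ∑ j, x j = 0 ∧ ∀ j, ∃ a : ℤ, x j = a}
  zero_mem' := ⟨by simp, fun _ => ⟨0, by simp⟩⟩
  add_mem' := by
    rintro x y ⟨hx, hx'⟩ ⟨hy, hy'⟩
    refine ⟨by simp [Finset.sum_add_distrib, hx, hy], fun j => ?_⟩
    obtain ⟨a, ha⟩ := hx' j
    obtain ⟨b, hb⟩ := hy' j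
    exact ⟨a + b, by simp [ha, hb]⟩
  smul_mem' := by
    rintro c x ⟨hx, hx'⟩
    refine ⟨by simp [← Finset.mul_sum, hx], fun j => ?_⟩
    obtain ⟨a, ha⟩ := hx' j
    exact ⟨c * a, by simp [ha]⟩

/-- The weight lattice of `SL_m`: vectors in `ℚ^m` with zero sum of the coordinates whose pairing
with every (co)root `e_j - e_k` is an integer. -/
def weightLattice (m : ℕ) : Submodule ℤ (Fin m → ℚ) where
  carrier := {x | ∑ j, x j = 0 ∧ ∀ j k, ∃ a : ℤ, x j - x k = a}
  zero_mem' := ⟨by simp, fun _ _ => ⟨0, by simp⟩⟩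
  add_mem' := by
    rintro x y ⟨hx, hx'⟩ ⟨hy, hy'⟩
    refine ⟨by simp [Finset.sum_add_distrib, hx, hy], fun j k => ?_⟩
    obtain ⟨a, ha⟩ := hx' j k
    obtain ⟨b, hb⟩ := hy' j k
    refine ⟨a + b, ?_⟩
    push_cast
    rw [← ha, ← hb]
    simp only [Pi.add_apply]
    ring
  smul_mem' := by
    rintro c x ⟨hx, hx'⟩
    refine ⟨by simp [← Finset.mul_sum, hx], fun j k => ?_⟩
    obtain ⟨a, ha⟩ := hx' j k
    refine ⟨c * a, ?_⟩
    push_cast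
    rw [← ha]
    simp only [Pi.smul_apply, zsmul_eq_mul]
    ring

/-- The first fundamental weight `ω = e_1 - (1/m) (e_1 + ⋯ + e_m)
= (1/m) [(m-1) α_1 + (m-2) α_2 + ⋯ + α_{m-1}]`, where `α_k = e_k - e_{k+1}`. Its class generates
the cyclic group `weightLattice m / rootLattice m`, which has order `m`. -/
def omega (m : ℕ) : Fin m → ℚ := fun j => (if (j : ℕ) = 0 then 1 else 0) - 1 / (m : ℚ)

theorem omega_mem (m : ℕ) : omega m ∈ weightLattice m := by
  refine ⟨?_, fun j k => ?_⟩
  · cases m with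
    | zero => simp
    | succ m =>
      have h : (m : ℚ) + 1 ≠ 0 := by positivity
      simp only [omega, Finset.sum_sub_distrib, Fin.sum_univ_succ]
      simp
      field_simp
      ring
  · refine ⟨(if (j : ℕ) = 0 then 1 else 0) - (if (k : ℕ) = 0 then 1 else 0), ?_⟩
    simp only [omega]
    push_cast
    ring

section Product

variable {r : ℕ} (n : Fin r → ℕ)

/-- The ambient space `⨁ ℚ^{n_i}` of all the lattices below. -/
abbrev Ambient : Type := (i : Fin r) → Fin (n i) → ℚ

/-- `Q = ⨁ Q_i`. -/
def prodRootLattice : Submodule ℤ (Ambient n) :=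
  Submodule.pi Set.univ fun i => rootLattice (n i)

/-- `P = ⨁ P_i`. -/
def prodWeightLattice : Submodule ℤ (Ambient n) :=
  Submodule.pi Set.univ fun i => weightLattice (n i)

/-- `F = P / Q`, which is `⨁ ℤ / n_i ℤ` with the classes of the `omega (n i)` as the standard
generators of the summands. -/
abbrev fundamentalQuotient : Type :=
  prodWeightLattice n ⧸ (prodRootLattice n).submoduleOf (prodWeightLattice n)

/-- `W = ∏ S_{n_i}`. -/
abbrev WeylGroup : Type := (i : Fin r) → Equiv.Perm (Fin (n i))

/-- The action of `W` on the ambient space by permutation of the standard basis vectors: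
`w` takes `e_{j, i}` to `e_{w_i j, i}`. -/
def weylRep : Representation ℤ (WeylGroup n) (Ambient n) where
  toFun w :=
    { toFun := fun x i j => x i ((w i)⁻¹ j)
      map_add' := fun _ _ => rfl
      map_smul' := fun _ _ => rfl }
  map_one' := rfl
  map_mul' _ _ := rfl

/-- The vector `∑ ν_i (n_i / d) ω_i` of `P`. -/
def nuVector (d : ℕ) (ν : Fin r → ℤ) : prodWeightLattice n :=
  ⟨fun i => (ν i * ((n i / d : ℕ) : ℤ)) • omega (n i),
    fun i _ => Submodule.smul_mem _ _ (omega_mem (n i))⟩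

/-- The cyclic subgroup `S_ν ⊆ (ℤ / d)^r ⊆ ⨁ ℤ / n_i = F` generated by the image of `ν`.
Here `ℤ / d` is embedded in `ℤ / n_i` as the subgroup of order `d`, by `1 ↦ n_i / d`
(`d` is a divisor of all `n_i`, so the division is exact). -/
def nuSubgroup (d : ℕ) (ν : Fin r → ℤ) : Submodule ℤ (fundamentalQuotient n) :=
  Submodule.span ℤ {Submodule.Quotient.mk (nuVector n d ν)}

/-- The intermediate lattice `Q ⊆ L_ν ⊆ P`: the preimage in `P` of `S_ν` under `P → F`. -/
def nuLattice (d : ℕ) (ν : Fin r → ℤ) : Submodule ℤ (Ambient n) :=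
  ((nuSubgroup n d ν).comap
    ((prodRootLattice n).submoduleOf (prodWeightLattice n)).mkQ).map
      (prodWeightLattice n).subtype

variable {n}

theorem weylRep_mem_prodWeightLattice (w : WeylGroup n) {x : Ambient n}
    (hx : x ∈ prodWeightLattice n) : weylRep n w x ∈ prodWeightLattice n := fun i hi =>
  ⟨(Equiv.sum_comp (w i)⁻¹ (x i)).trans (hx i hi).1, fun _ _ => (hx i hi).2 _ _⟩

/-- `W` acts trivially on `P / Q`. -/
theorem weylRep_sub_mem_prodRootLattice (w : WeylGroup n) {x : Ambient n}
    (hx : x ∈ prodWeightLattice n) : weylRep n w x - x ∈ prodRootLattice n := fun i hi => by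
  refine ⟨?_, fun j => (hx i hi).2 ((w i)⁻¹ j) j⟩
  have h := (weylRep_mem_prodWeightLattice w hx i hi).1
  have h' := (hx i hi).1
  simp only [Pi.sub_apply, Finset.sum_sub_distrib, h, h', sub_zero]

theorem nuLattice_invariant (d : ℕ) (ν : Fin r → ℤ) (w : WeylGroup n) :
    nuLattice n d ν ≤ (nuLattice n d ν).comap (weylRep n w) := by
  rintro _ ⟨⟨x, hx⟩, hxS, rfl⟩
  refine ⟨⟨weylRep n w x, weylRep_mem_prodWeightLattice w hx⟩, ?_, rfl⟩
  have h : (Submodule.Quotient.mk ⟨weylRep n w x, weylRep_mem_prodWeightLattice w hx⟩ :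
      fundamentalQuotient n) = Submodule.Quotient.mk ⟨x, hx⟩ :=
    (Submodule.Quotient.eq _).2 (weylRep_sub_mem_prodRootLattice w hx)
  change Submodule.Quotient.mk _ ∈ nuSubgroup n d ν
  rw [h]
  exact hxS

variable (n)

/-- `L_ν` as a `W`-lattice. -/
def nuLatticeRep (d : ℕ) (ν : Fin r → ℤ) :
    Representation ℤ (WeylGroup n) (nuLattice n d ν) :=
  (weylRep n).subrepresentation (nuLattice n d ν) (nuLattice_invariant d ν)

end Product

end TypeA

/-!
# Non-quasi-permutation lattices of type `A`

Let `X` be the set of all coordinates, `s_i` the sum of the basis vectors of the `i`-th block, and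
`N = ℤ^X + ℤ (1/d) ∑ ν_i s_i`. Taking the sums over the blocks gives a `W`-equivariant surjection
of `N` onto the trivial lattice `ℤ^r`, with kernel `L_ν`. Since `H¹(W, E) = 0` for a permutation
lattice `E`, a sequence `0 → L_ν → E → E' → 0` with `E` and `E'` permutation lattices yields
`0 → N → E ⊕ ℤ^r → E' → 0` (`TypeA.exists_permResolution`). So it is enough to show that
`0 → N → ℤ^Y → ℤ^Y' → 0` cannot be exact for finite `W`-sets `Y` and `Y'`. Let `p` be a prime
divisor of `d`.

For odd `p` let `σ ∈ W` have order `p` and no fixed points on `X`, and put `C = ⟨σ⟩`. Then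
`Ĥ⁰(C, ℤ^Y)` has the `C`-fixed points of `Y` as a basis over `𝔽_p`, while `Ĥ⁰(C, N)` and `H¹(C, N)`
are one-dimensional; the resulting four-term exact sequence is
`PermResolution.nonempty_fixedPointSequence`.

* If `p ≥ 5`, choose `τ` normalising `C` and acting on `ℤ/p` as multiplication by `2`. On `Ĥ⁰(C, N)`
  it acts trivially, and on `H¹(C, N)` by a character `k ≠ k⁻¹`. The permutation representations of
  `τ` on the middle terms are self-dual, so comparing the traces of `τ` and `τ⁻¹` gives `k = k⁻¹`
  (`PermResolution.false_of_character`).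
* If `p = 3`, there are at least two triples of coordinates that `σ` rotates; let `π` rotate just one
  of them. Both `π` and `σ⁻¹ π` have fixed points on `X`, which forces `H¹(⟨σ, π⟩, N) = 0`, while the
  class of `1/d ∑ ν_i s_i` stays nontrivial after passing to `π`-invariants. A dimension count then
  contradicts the fact that the orbits of `π` have odd length (`PermResolution.false_of_bicyclic`).

If `d` is a power of `2`, there are at least three pairs of coordinates. Two involutions `g₁` and
`g₂`, each of which swaps all pairs but one, generate a four-group `Γ`. A permutation lattice has
no nonzero class in `H²(Γ, ·)` which is trivial on all cyclic subgroups, and the same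
follows for `N`. But `N` has such a class: let `e` be half of `∑ ν_x x` over the fixed points `x` of
`g₁`, and take the cochain that is `e` at `g₁` and at `g₂` and `0` at `g₁ g₂`, modulo `N`
(`PermResolution.exists_permRep_sub_eq` and `PermResolution.false_of_four_group`).
-/

/-! ### Permutation modules -/

/-- The permutation module `R^Y`: a permutation `b` moves the basis vector at `y` to the one
at `b y`, so that `(b v) y = v (b⁻¹ y)`. -/
def permRep (R : Type*) [CommRing R] (Y : Type*) : Equiv.Perm Y →* Module.End R (Y → R) where
  toFun b := LinearMap.funLeft R R b.symm
  map_one' := rfl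
  map_mul' _ _ := rfl

section PermRep

variable {R : Type*} [CommRing R] {Y : Type*}

@[simp]
theorem permRep_apply (b : Equiv.Perm Y) (v : Y → R) (y : Y) :
    permRep R Y b v y = v (b.symm y) := rfl

theorem permRep_apply_apply (b : Equiv.Perm Y) (v : Y → R) (y : Y) :
    permRep R Y b v (b y) = v y := by simp

theorem permRep_single [DecidableEq Y] (b : Equiv.Perm Y) (y : Y) (c : R) :
    permRep R Y b (Pi.single y c) = Pi.single (b y) c := by
  ext z
  simp [Pi.single_apply, Equiv.symm_apply_eq]

/-- The norm `1 + b + ⋯ + b ^ (p - 1)` on a permutation module. -/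
def permNorm (R : Type*) [CommRing R] {Y : Type*} (b : Equiv.Perm Y) (p : ℕ) :
    Module.End R (Y → R) :=
  ∑ i ∈ Finset.range p, permRep R Y b ^ i

theorem permNorm_apply (b : Equiv.Perm Y) (p : ℕ) (v : Y → R) (y : Y) :
    permNorm R b p v y = ∑ i ∈ Finset.range p, v ((b⁻¹ ^ i) y) := by
  simp [permNorm, ← map_pow, Finset.sum_apply, ← Equiv.Perm.inv_def]

theorem permNorm_permRep_sub {b : Equiv.Perm Y} {p : ℕ} (hb : b ^ p = 1) (v : Y → R) :
    permNorm R b p (permRep R Y b v - v) = 0 := by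
  have h := geom_sum_mul (permRep R Y b) p
  rw [← map_pow, hb, map_one, sub_self] at h
  exact LinearMap.congr_fun h v

theorem permRep_permNorm {b : Equiv.Perm Y} {p : ℕ} (hb : b ^ p = 1) (v : Y → R) :
    permRep R Y b (permNorm R b p v) = permNorm R b p v := by
  have h := mul_geom_sum (permRep R Y b) p
  rw [← map_pow, hb, map_one, sub_self] at h
  exact sub_eq_zero.1 (LinearMap.congr_fun h v)

theorem permRep_pow_of_invariant {b : Equiv.Perm Y} {v : Y → R} (hv : permRep R Y b v = v)
    (i : ℕ) : (permRep R Y b ^ i) v = v := by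
  induction i with
  | zero => rfl
  | succ i ih => rw [pow_succ, Module.End.mul_apply, hv, ih]

theorem permNorm_apply_of_fixed {b : Equiv.Perm Y} {y : Y} (hy : b y = y) (p : ℕ) (v : Y → R) :
    permNorm R b p v y = p * v y := by
  have h (i : ℕ) : (b⁻¹ ^ i) y = y := by
    rw [inv_pow, Equiv.Perm.inv_eq_iff_eq, Equiv.Perm.coe_pow]
    exact (Function.IsFixedPt.iterate hy i).symm
  rw [permNorm_apply, Finset.sum_congr rfl fun i _ => by rw [h i]]
  simp

theorem apply_inv_pow_eq_iff (b : Equiv.Perm Y) (i : ℕ) (y : Y) :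
    b ((b⁻¹ ^ i) y) = (b⁻¹ ^ i) y ↔ b y = y := by
  have h : b * b⁻¹ ^ i = b⁻¹ ^ i * b := ((Commute.refl b).inv_right.pow_right i).eq
  rw [← Equiv.Perm.mul_apply, h, Equiv.Perm.mul_apply, EmbeddingLike.apply_eq_iff_eq]

/-- A function `v` that is constant modulo `m` along the classes of `r` is the sum of a function
constant along these classes and a multiple of `m`. -/
theorem exists_invariant_add_smul (r : Setoid Y) (m : ℤ) (v : Y → ℤ)
    (h : ∀ x y, r x y → m ∣ v x - v y) :
    ∃ t e : Y → ℤ, (∀ x y, r x y → t x = t y) ∧ v = t + m • e := by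
  choose e he using fun x => h x (Quotient.out (Quotient.mk r x)) (r.symm (Quotient.mk_out x))
  refine ⟨fun x => v (Quotient.out (Quotient.mk r x)), e, fun x y hxy => ?_, ?_⟩
  · simp only [Quotient.sound hxy]
  · ext x
    simp only [Pi.add_apply, Pi.smul_apply, smul_eq_mul, ← he x]
    ring

/-- A transversal of the nontrivial orbits of a permutation of prime order, written as an
indicator function. -/
theorem exists_transversal (R : Type*) [CommRing R] {p : ℕ} (hp : p.Prime) {b : Equiv.Perm Y}
    (hb : b ^ p = 1) :
    ∃ c : Y → R, (∀ y, b y ≠ y → permNorm R b p c y = 1) ∧ ∀ y, b y = y → c y = 0 := by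
  classical
  let s : Setoid Y := Equiv.Perm.SameCycle.setoid b⁻¹
  let ρ : Y → Y := fun y => Quotient.out (Quotient.mk s y)
  refine ⟨fun y => if b y ≠ y ∧ ρ y = y then 1 else 0, fun y hy => ?_, fun y hy => by simp [hy]⟩
  have hb' : b⁻¹ ^ p = 1 := by rw [inv_pow, hb, inv_one]
  have hfix (i : ℕ) : b ((b⁻¹ ^ i) y) ≠ (b⁻¹ ^ i) y := mt (apply_inv_pow_eq_iff b i y).1 hy
  have hρ (i : ℕ) : ρ ((b⁻¹ ^ i) y) = ρ y := by
    have : s ((b⁻¹ ^ i) y) y := Equiv.Perm.SameCycle.symm ⟨i, by simp⟩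
    simp only [ρ, Quotient.sound this]
  simp only [permNorm_apply, hρ, hfix, ne_eq, not_false_eq_true, true_and]
  obtain ⟨k, hk⟩ : ∃ k : ℤ, (b⁻¹ ^ k) y = ρ y := s.symm (Quotient.mk_out y)
  have hp0 : (0 : ℤ) < p := by exact_mod_cast hp.pos
  have hpz : (b⁻¹) ^ (p : ℤ) = 1 := by rw [zpow_natCast, hb']
  have hmod (k : ℤ) : b⁻¹ ^ k = b⁻¹ ^ (k % p) := by
    conv_lhs => rw [← Int.emod_add_mul_ediv k p, zpow_add, zpow_mul, hpz, one_zpow, mul_one]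
  obtain ⟨j, hj⟩ := Int.eq_ofNat_of_zero_le (Int.emod_nonneg k hp0.ne')
  have hjp : j < p := by
    have := Int.emod_lt_of_pos k hp0
    omega
  have hj' : (b⁻¹ ^ j) y = ρ y := by
    rw [← hk, hmod k, hj, zpow_natCast]
  rw [Finset.sum_eq_single_of_mem j (Finset.mem_range.2 hjp)]
  · rw [if_pos hj'.symm]
  · intro i hi hij
    rw [if_neg]
    intro h
    have hper : Function.minimalPeriod (⇑b⁻¹) y = p := by
      have : Fact p.Prime := ⟨hp⟩
      refine Function.minimalPeriod_eq_prime ?_ ?_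
      · change (⇑b⁻¹)^[p] y = y
        rw [← Equiv.Perm.coe_pow, hb']; rfl
      · intro h'
        exact hy ((Equiv.Perm.inv_eq_iff_eq.1 h').symm)
    refine hij ?_
    have := Function.iterate_injOn_Iio_minimalPeriod (f := ⇑b⁻¹) (x := y)
    refine this ?_ ?_ ?_
    · rw [hper]; exact Finset.mem_range.1 hi
    · rw [hper]; exact hjp
    · simp only [← Equiv.Perm.coe_pow]
      rw [hj', ← h]

/-- `Ĥ⁰` of a cyclic group of prime order with values in a permutation module is detected on the
fixed points: an invariant function is a norm as soon as it is divisible by `p` there. -/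
theorem exists_permNorm_eq {p : ℕ} (hp : p.Prime) {b : Equiv.Perm Y} (hb : b ^ p = 1)
    {v : Y → R} (hv : permRep R Y b v = v) (h : ∀ y, b y = y → (p : R) ∣ v y) :
    ∃ e, permNorm R b p e = v := by
  classical
  obtain ⟨c, hc, hc0⟩ := exists_transversal R hp hb
  choose! q hq using h
  refine ⟨fun y => if b y = y then q y else c y * v y, ?_⟩
  ext y
  by_cases hy : b y = y
  · rw [permNorm_apply_of_fixed hy, if_pos hy, hq y hy]
  · have hinv (i : ℕ) : v ((b⁻¹ ^ i) y) = v y := by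
      have := congrFun (permRep_pow_of_invariant hv i) y
      simpa [← map_pow, ← Equiv.Perm.inv_def] using this
    have hfix (i : ℕ) : b ((b⁻¹ ^ i) y) ≠ (b⁻¹ ^ i) y := mt (apply_inv_pow_eq_iff b i y).1 hy
    have := hc y hy
    rw [permNorm_apply] at this ⊢
    simp only [hfix, if_false, hinv]
    rw [← Finset.sum_mul, this, one_mul]

end PermRep

section Cohomology

variable {Y : Type*}

/-- `H¹` of a finite group with values in a permutation lattice vanishes. Averaging trivialises a
cocycle over `ℚ`; the denominators can be removed orbit by orbit. -/
theorem exists_eq_permRep_sub {Γ : Type*} [Group Γ] [Finite Γ] (β : Γ →* Equiv.Perm Y)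
    (c : Γ → Y → ℤ) (hc : ∀ g h, c (g * h) = c g + permRep ℤ Y (β g) (c h)) :
    ∃ v, ∀ g, c g = permRep ℤ Y (β g) v - v := by
  classical
  have := Fintype.ofFinite Γ
  have hS (g : Γ) : permRep ℤ Y (β g) (∑ h, c h) = (∑ h, c h) - (Fintype.card Γ : ℤ) • c g := by
    have h1 : ∑ h, c (g * h) = ∑ h, c h := Equiv.sum_comp (Equiv.mulLeft g) c
    simp only [hc, Finset.sum_add_distrib, Finset.sum_const, ← map_sum] at h1
    rw [eq_sub_iff_add_eq']
    simpa [-map_sum] using h1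
  let _ : MulAction Γ Y := MulAction.compHom Y β
  obtain ⟨t, e, ht, he⟩ := exists_invariant_add_smul (MulAction.orbitRel Γ Y)
    (Fintype.card Γ : ℤ) (∑ h, c h) (by
      rintro _ y ⟨g, rfl⟩
      have := congrFun (hS g) (g • y)
      rw [show g • y = β g y from rfl, permRep_apply_apply] at this
      change _ ∣ _ - (∑ h, c h) _
      rw [this]
      exact ⟨c g (β g y), by simp [show g • y = β g y from rfl]⟩)
  have ht' (g : Γ) : permRep ℤ Y (β g) t = t := by
    ext y
    rw [permRep_apply]
    refine ht _ _ ⟨g⁻¹, ?_⟩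
    change β g⁻¹ y = _
    rw [map_inv]; rfl
  refine ⟨-e, fun g => ?_⟩
  have h := hS g
  rw [he, map_add, map_smul, ht'] at h
  have hcard : (Fintype.card Γ : ℤ) ≠ 0 := by simp
  refine smul_right_injective _ hcard ?_
  simp only [smul_sub, map_neg, smul_neg]
  linear_combination h

/-- `Ĥ⁻¹` of a cyclic group with values in a permutation lattice vanishes. -/
theorem exists_eq_permRep_sub_of_permNorm_eq_zero {p : ℕ} (hp : p ≠ 0) {b : Equiv.Perm Y}
    {v : Y → ℤ} (hv : permNorm ℤ b p v = 0) :
    ∃ e, v = permRep ℤ Y b e - e := by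
  set T := permRep ℤ Y b with hT
  let S : Y → ℤ := ∑ i ∈ Finset.range p, (∑ j ∈ Finset.range i, T ^ j) v
  have hS : T S = S - (p : ℤ) • v := by
    have h1 (i : ℕ) : T ((∑ j ∈ Finset.range i, T ^ j) v) =
        (∑ j ∈ Finset.range (i + 1), T ^ j) v - v := by
      rw [Finset.sum_range_succ']
      simp [pow_succ', LinearMap.sum_apply, map_sum]
    have h2 : ∑ i ∈ Finset.range p, (∑ j ∈ Finset.range (i + 1), T ^ j) v = S := by
      have := Finset.sum_range_succ (fun i => (∑ j ∈ Finset.range i, T ^ j) v) p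
      rw [Finset.sum_range_succ'] at this
      simpa only [Finset.range_zero, Finset.sum_empty, LinearMap.zero_apply, add_zero,
        show (∑ j ∈ Finset.range p, T ^ j) v = 0 from hv] using this
    simp only [S, map_sum] at h2 ⊢
    simp only [h1, Finset.sum_sub_distrib, h2]
    simp
  obtain ⟨t, e, ht, he⟩ := exists_invariant_add_smul (Equiv.Perm.SameCycle.setoid b) p S (by
    have hstep (x : Y) : (p : ℤ) ∣ S (b x) - S x := by
      have := congrFun hS (b x)
      rw [hT, permRep_apply_apply] at this
      rw [this]
      exact ⟨v (b x), by simp⟩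
    have hpow (n : ℕ) (x : Y) : (p : ℤ) ∣ S ((b ^ n) x) - S x := by
      induction n with
      | zero => simp
      | succ n ih =>
        have h := hstep ((b ^ n) x)
        rw [pow_succ', Equiv.Perm.mul_apply]
        simpa using dvd_add h ih
    rintro x y ⟨k, rfl⟩
    obtain ⟨n, rfl | rfl⟩ := k.eq_nat_or_neg
    · rw [zpow_natCast, dvd_sub_comm]
      exact hpow n x
    · have := hpow n ((b ^ (-(n : ℤ))) x)
      rwa [← Equiv.Perm.mul_apply, ← zpow_natCast, ← zpow_add, add_neg_cancel, zpow_zero,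
        Equiv.Perm.one_apply] at this)
  have ht' : T t = t := by
    ext y
    exact ht _ _ ⟨1, by simp⟩
  refine ⟨-e, ?_⟩
  rw [he, map_add, map_smul, ht'] at hS
  have hp' : (p : ℤ) ≠ 0 := by exact_mod_cast hp
  refine smul_right_injective _ hp' ?_
  simp only [smul_sub, map_neg, smul_neg]
  linear_combination hS

end Cohomology

/-! ### Resolutions of twisted lattices -/

/-- The vectors `z` in `ℤ^X` which are congruent modulo `d` to a multiple of `μ`. -/
def twistedLattice {X : Type*} (d : ℤ) (μ : X → ℤ) : Submodule ℤ (X → ℤ) where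
  carrier := {z | ∃ t : ℤ, ∀ x, d ∣ z x - t * μ x}
  zero_mem' := ⟨0, by simp⟩
  add_mem' := by
    rintro a b ⟨s, hs⟩ ⟨t, ht⟩
    refine ⟨s + t, fun x => ?_⟩
    refine (dvd_add (hs x) (ht x)).trans (dvd_of_eq ?_)
    simp only [Pi.add_apply]
    ring
  smul_mem' := by
    rintro c a ⟨s, hs⟩
    refine ⟨c * s, fun x => ?_⟩
    refine ((hs x).mul_left c).trans (dvd_of_eq ?_)
    simp only [Pi.smul_apply, smul_eq_mul]
    ring

/-- A short exact sequence `0 → N → ℤ^Y → ℤ^Y' → 0` of lattices for the group `W`, where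
`N = (1/d) twistedLattice d μ`, and `W` permutes `X`, `Y` and `Y'`. The first map is
recorded by its restriction `F` to the sublattice `ℤ^X` of `N`; its value at `z / d` is the vector
`e` with `F z = d e`. -/
structure PermResolution {W X Y Y' : Type*} [Group W] (d : ℤ) (μ : X → ℤ)
    (α : W →* Equiv.Perm X) (β : W →* Equiv.Perm Y) (β' : W →* Equiv.Perm Y') where
  /-- The restriction of the first map to `ℤ^X`. -/
  F : (X → ℤ) →ₗ[ℤ] (Y → ℤ)
  /-- The second map. -/
  G : (Y → ℤ) →ₗ[ℤ] (Y' → ℤ)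
  d_ne : d ≠ 0
  mu_apply : ∀ w x, μ (α w x) = μ x
  isCoprime : ∀ x, IsCoprime (μ x) d
  F_comm : ∀ w v, F (permRep ℤ X (α w) v) = permRep ℤ Y (β w) (F v)
  G_comm : ∀ w v, G (permRep ℤ Y (β w) v) = permRep ℤ Y' (β' w) (G v)
  F_inj : Function.Injective F
  G_surj : Function.Surjective G
  exists_of_mem : ∀ z ∈ twistedLattice d μ, ∃ e, F z = d • e ∧ G e = 0
  exists_of_G_eq_zero : ∀ e, G e = 0 → ∃ z ∈ twistedLattice d μ, F z = d • e

/-! ### Reduction to fixed points -/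

/-- The points fixed by a permutation. -/
abbrev FixPt {Y : Type*} (b : Equiv.Perm Y) : Type _ := {y // b y = y}

/-- Restriction to the fixed points, followed by reduction modulo `p`. For `b` of order `p` it
identifies `Ĥ⁰(⟨b⟩, ℤ^Y)` with `𝔽_p^(FixPt b)`. -/
def fixRed {Y : Type*} (p : ℕ) (b : Equiv.Perm Y) : (Y → ℤ) →+ (FixPt b → ZMod p) where
  toFun v y := (v y : ZMod p)
  map_zero' := by ext; simp
  map_add' _ _ := by ext; simp

open Classical in
/-- The lift of a function on the fixed points modulo `p` by integers between `0` and `p - 1`,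
extended by zero. -/
noncomputable def fixLift {Y : Type*} {p : ℕ} {b : Equiv.Perm Y} (a : FixPt b → ZMod p) : Y → ℤ :=
  fun y => if h : b y = y then (a ⟨y, h⟩).cast else 0

section FixPt

variable {Y : Type*} {p : ℕ} {b : Equiv.Perm Y}

theorem fixRed_apply (v : Y → ℤ) (y : FixPt b) : fixRed p b v y = (v y : ZMod p) := rfl

theorem fixRed_fixLift (a : FixPt b → ZMod p) : fixRed p b (fixLift a) = a := by
  ext y
  rw [fixRed_apply, fixLift, dif_pos y.2, ZMod.intCast_zmod_cast]

theorem permRep_fixLift (a : FixPt b → ZMod p) : permRep ℤ Y b (fixLift a) = fixLift a := by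
  ext y
  obtain ⟨y, rfl⟩ := b.surjective y
  rw [permRep_apply_apply]
  by_cases h : b y = y
  · rw [h]
  · have h' : b (b y) ≠ b y := fun h' => h (b.injective h')
    rw [fixLift, fixLift, dif_neg h, dif_neg h']

theorem fixRed_permNorm (v : Y → ℤ) : fixRed p b (permNorm ℤ b p v) = 0 := by
  ext y
  simp [fixRed_apply, permNorm_apply_of_fixed y.2]

theorem exists_permNorm_eq_of_fixRed_eq_zero (hp : p.Prime) (hb : b ^ p = 1) {v : Y → ℤ}
    (hv : permRep ℤ Y b v = v) (h : fixRed p b v = 0) : ∃ e, permNorm ℤ b p e = v :=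
  exists_permNorm_eq hp hb hv fun y hy =>
    (ZMod.intCast_zmod_eq_zero_iff_dvd _ _).1 (congrFun h ⟨y, hy⟩)

end FixPt

namespace PermResolution

variable {W X Y Y' : Type*} [Group W] {d : ℤ} {μ : X → ℤ}
  {α : W →* Equiv.Perm X} {β : W →* Equiv.Perm Y} {β' : W →* Equiv.Perm Y'}

theorem permRep_mu (R : PermResolution d μ α β β') (w : W) : permRep ℤ X (α w) μ = μ := by
  ext x
  rw [permRep_apply, ← R.mu_apply w, Equiv.apply_symm_apply]

theorem F_permNorm (R : PermResolution d μ α β β') (σ : W) (p : ℕ) (v : X → ℤ) :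
    R.F (permNorm ℤ (α σ) p v) = permNorm ℤ (β σ) p (R.F v) := by
  simp [permNorm, LinearMap.sum_apply, map_sum, ← map_pow, R.F_comm]

theorem G_permNorm (R : PermResolution d μ α β β') (σ : W) (p : ℕ) (v : Y → ℤ) :
    R.G (permNorm ℤ (β σ) p v) = permNorm ℤ (β' σ) p (R.G v) := by
  simp [permNorm, LinearMap.sum_apply, map_sum, ← map_pow, R.G_comm]

theorem smul_right_cancel (R : PermResolution d μ α β β') {A : Type*} {v w : A → ℤ}
    (h : d • v = d • w) : v = w :=
  smul_right_injective (A → ℤ) R.d_ne h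

theorem G_F (R : PermResolution d μ α β β') (v : X → ℤ) : R.G (R.F v) = 0 := by
  obtain ⟨e, he, he'⟩ := R.exists_of_mem (d • v) ⟨0, fun x => by simp⟩
  rw [map_smul] at he
  rw [R.smul_right_cancel he, he']

theorem exists_eq_smul_of_dvd {A : Type*} {v : A → ℤ} {d : ℤ} (h : ∀ x, d ∣ v x) :
    ∃ w, v = d • w := by
  choose w hw using h
  exact ⟨w, funext hw⟩

/-- The norm of an element of the twisted lattice, at a point. -/
theorem dvd_permNorm_sub (R : PermResolution d μ α β β') {z : X → ℤ} {t : ℤ}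
    (hz : ∀ x, d ∣ z x - t * μ x) (w : W) (p : ℕ) (x : X) :
    d ∣ permNorm ℤ (α w) p z x - p * t * μ x := by
  have h (i : ℕ) : μ (((α w)⁻¹ ^ i) x) = μ x := by
    rw [← map_inv, ← map_pow, R.mu_apply]
  rw [permNorm_apply]
  have : (p : ℤ) * t * μ x = ∑ i ∈ Finset.range p, t * μ (((α w)⁻¹ ^ i) x) := by
    rw [Finset.sum_congr rfl fun i _ => by rw [h i]]
    simp [mul_assoc]
  rw [this, ← Finset.sum_sub_distrib]
  exact Finset.dvd_sum fun i _ => hz _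

/-- If `F z / d` is a coboundary of `w`, then `z` has norm zero. -/
theorem permNorm_eq_zero (R : PermResolution d μ α β β') {w : W} {p : ℕ} (hw : w ^ p = 1)
    {z : X → ℤ} {e : Y → ℤ} (h : R.F z = d • (permRep ℤ Y (β w) e - e)) :
    permNorm ℤ (α w) p z = 0 := by
  apply R.F_inj
  rw [F_permNorm, h, map_smul, permNorm_permRep_sub (by rw [← map_pow, hw, map_one]), smul_zero,
    map_zero]

section PrimeOrder

variable {p : ℕ} {m : ℤ} {σ : W}

theorem fixRed_eq_smul (R : PermResolution d μ α β β') (hp : p.Prime) (hσ : σ ^ p = 1)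
    (hfree : ∀ x, α σ x ≠ x) {eμ : Y → ℤ} (heμ : R.F μ = d • eμ) {z : X → ℤ} {t : ℤ}
    (hz : permRep ℤ X (α σ) z = z) (hzt : ∀ x, d ∣ z x - t * μ x) {e : Y → ℤ}
    (he : R.F z = d • e) : fixRed p (β σ) e = t • fixRed p (β σ) eμ := by
  obtain ⟨w, hw⟩ := exists_eq_smul_of_dvd (v := z - t • μ) (d := d) (by simpa using hzt)
  have hwinv : permRep ℤ X (α σ) w = w := by
    refine R.smul_right_cancel ?_
    rw [← map_smul, ← hw, map_sub, map_smul, hz, R.permRep_mu]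
  obtain ⟨w1, rfl⟩ := exists_permNorm_eq hp (by rw [← map_pow, hσ, map_one]) hwinv
    fun x hx => absurd hx (hfree x)
  have : e = t • eμ + R.F (permNorm ℤ (α σ) p w1) := by
    refine R.smul_right_cancel ?_
    rw [smul_add, ← he, ← map_smul, ← hw, smul_comm, ← heμ, map_sub, map_smul]
    abel
  rw [this, map_add, F_permNorm, fixRed_permNorm, add_zero, map_zsmul]

theorem exists_class (R : PermResolution d μ α β β') [Nonempty X] (hp : p ≠ 0) (hd : d = p * m)
    (hσ : σ ^ p = 1) {z : X → ℤ} (hz : z ∈ twistedLattice d μ) {e : Y → ℤ}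
    (h : R.F z = d • (permRep ℤ Y (β σ) e - e)) :
    ∃ c : ℤ, ∀ x, d ∣ z x - c * m * μ x := by
  obtain ⟨t, ht⟩ := hz
  obtain ⟨x⟩ := ‹Nonempty X›
  have h1 := R.dvd_permNorm_sub ht σ p x
  rw [R.permNorm_eq_zero hσ h, Pi.zero_apply, zero_sub, dvd_neg] at h1
  have h2 := (R.isCoprime x).symm.dvd_of_dvd_mul_right h1
  rw [hd] at h2
  obtain ⟨c, rfl⟩ := (mul_dvd_mul_iff_left (by exact_mod_cast hp)).1 h2
  exact ⟨c, fun x => by simpa [mul_comm c] using ht x⟩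

/-- The relation defining the connecting map `Ĥ⁰(⟨σ⟩, ℤ^Y') → H¹(⟨σ⟩, N)`. -/
def Connects (R : PermResolution d μ α β β') (p : ℕ) (m : ℤ) (σ : W)
    (b : FixPt (β' σ) → ZMod p) (c : ℤ) : Prop :=
  ∃ (e : Y → ℤ) (z : X → ℤ), permRep ℤ Y' (β' σ) (R.G e) = R.G e ∧
    fixRed p (β' σ) (R.G e) = b ∧ R.F z = d • (permRep ℤ Y (β σ) e - e) ∧
    ∀ x, d ∣ z x - c * m * μ x

theorem Connects.sub {R : PermResolution d μ α β β'} {b b' : FixPt (β' σ) → ZMod p} {c c' : ℤ}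
    (h : R.Connects p m σ b c) (h' : R.Connects p m σ b' c') :
    R.Connects p m σ (b - b') (c - c') := by
  obtain ⟨e, z, h1, h2, h3, h4⟩ := h
  obtain ⟨e', z', h1', h2', h3', h4'⟩ := h'
  refine ⟨e - e', z - z', ?_, ?_, ?_, fun x => ?_⟩
  · simp [h1, h1']
  · simp [h2, h2']
  · rw [map_sub, h3, h3', map_sub, ← smul_sub]
    congr 1
    abel
  · refine (dvd_sub (h4 x) (h4' x)).trans (dvd_of_eq ?_)
    simp only [Pi.sub_apply]
    ring

theorem exists_connects (R : PermResolution d μ α β β') [Nonempty X] (hp : p ≠ 0)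
    (hd : d = p * m) (hσ : σ ^ p = 1) (b : FixPt (β' σ) → ZMod p) :
    ∃ c, R.Connects p m σ b c := by
  obtain ⟨e, he⟩ := R.G_surj (fixLift b)
  obtain ⟨z, hz, hze⟩ := R.exists_of_G_eq_zero (permRep ℤ Y (β σ) e - e) (by
    rw [map_sub, R.G_comm, he, permRep_fixLift, sub_self])
  obtain ⟨c, hc⟩ := R.exists_class hp hd hσ hz hze
  exact ⟨c, e, z, by rw [he, permRep_fixLift], by rw [he, fixRed_fixLift], hze, hc⟩

theorem Connects.dvd {R : PermResolution d μ α β β'} [Nonempty X] (hp : p.Prime) (hd : d = p * m)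
    (hσ : σ ^ p = 1) {c : ℤ} (h : R.Connects p m σ 0 c) : (p : ℤ) ∣ c := by
  obtain ⟨e, z, h1, h2, h3, h4⟩ := h
  have hβ : β σ ^ p = 1 := by rw [← map_pow, hσ, map_one]
  obtain ⟨e', he'⟩ := exists_permNorm_eq_of_fixRed_eq_zero hp
    (by rw [← map_pow, hσ, map_one]) h1 h2
  obtain ⟨e1, rfl⟩ := R.G_surj e'
  obtain ⟨z2, ⟨t, ht⟩, hz2⟩ := R.exists_of_G_eq_zero (e - permNorm ℤ (β σ) p e1) (by
    rw [map_sub, G_permNorm, he', sub_self])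
  have hz : z = permRep ℤ X (α σ) z2 - z2 := by
    apply R.F_inj
    rw [h3, map_sub, R.F_comm, hz2, map_smul, map_sub, permRep_permNorm hβ, ← smul_sub]
    congr 1
    abel
  obtain ⟨x⟩ := ‹Nonempty X›
  have h5 : d ∣ z (α σ x) := by
    rw [hz, Pi.sub_apply, permRep_apply_apply]
    refine (dvd_sub (ht x) (ht (α σ x))).trans (dvd_of_eq ?_)
    rw [R.mu_apply]
    ring
  have h6 : d ∣ c * m * μ (α σ x) := by
    refine (dvd_sub h5 (h4 (α σ x))).trans (dvd_of_eq ?_)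
    ring
  have h7 := (R.isCoprime _).symm.dvd_of_dvd_mul_right h6
  have hm : m ≠ 0 := by
    rintro rfl
    exact R.d_ne (by simp [hd])
  rw [hd] at h7
  exact (mul_dvd_mul_iff_right hm).1 h7

/-- The exact sequence `0 → Ĥ⁰(C, N) → Ĥ⁰(C, ℤ^Y) → Ĥ⁰(C, ℤ^Y') → H¹(C, N) → 0` for the group `C`
generated by an element `σ` of prime order `p`, where `d = p m`, without fixed points on `X`. The
outer terms are one-dimensional over `𝔽_p`: the first is spanned by the class of `μ / d`, and
a class in the last is represented by a cocycle whose value at `σ` is `z / d` with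
`z ≡ c m μ` modulo `d`; the residue of `c` modulo `p` determines the class. -/
structure FixedPointSequence (R : PermResolution d μ α β β') (p : ℕ) (m : ℤ) (σ : W) where
  /-- The map induced by `G`. -/
  φ : (FixPt (β σ) → ZMod p) →ₗ[ZMod p] (FixPt (β' σ) → ZMod p)
  /-- The connecting map. -/
  θ : (FixPt (β' σ) → ZMod p) →ₗ[ZMod p] ZMod p
  /-- The class of `μ / d`. -/
  u : FixPt (β σ) → ZMod p
  φ_fixRed : ∀ e, permRep ℤ Y (β σ) e = e → φ (fixRed p (β σ) e) = fixRed p (β' σ) (R.G e)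
  fixRed_eq : ∀ z t, permRep ℤ X (α σ) z = z → (∀ x, d ∣ z x - t * μ x) →
    ∀ e, R.F z = d • e → fixRed p (β σ) e = t • u
  u_ne : u ≠ 0
  ker_φ : LinearMap.ker φ = Submodule.span _ {u}
  range_φ : LinearMap.range φ = LinearMap.ker θ
  θ_surj : Function.Surjective θ
  θ_eq : ∀ b c, R.Connects p m σ b c → θ b = (c : ZMod p)

theorem nonempty_fixedPointSequence (R : PermResolution d μ α β β') [Nonempty X]
    (hp : p.Prime) (hd : d = p * m) (hσ : σ ^ p = 1) (hfree : ∀ x, α σ x ≠ x) :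
    Nonempty (R.FixedPointSequence p m σ) := by
  have hα : α σ ^ p = 1 := by rw [← map_pow, hσ, map_one]
  have hβ : β σ ^ p = 1 := by rw [← map_pow, hσ, map_one]
  have hβ' : β' σ ^ p = 1 := by rw [← map_pow, hσ, map_one]
  have hpd : (p : ℤ) ∣ d := ⟨m, hd⟩
  have hp' : Prime (p : ℤ) := Nat.prime_iff_prime_int.1 hp
  -- `G` respects the reduction to the fixed points.
  have hG (e : Y → ℤ) (h : permRep ℤ Y (β σ) e = e) (h0 : fixRed p (β σ) e = 0) :
      fixRed p (β' σ) (R.G e) = 0 := by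
    obtain ⟨e, rfl⟩ := exists_permNorm_eq_of_fixRed_eq_zero hp hβ h h0
    rw [G_permNorm, fixRed_permNorm]
  have hsub (a a' : FixPt (β σ) → ZMod p) :
      fixRed p (β' σ) (R.G (fixLift (a - a'))) =
        fixRed p (β' σ) (R.G (fixLift a)) - fixRed p (β' σ) (R.G (fixLift a')) := by
    have := hG (fixLift (a - a') - (fixLift a - fixLift a'))
      (by simp only [map_sub, permRep_fixLift]) (by simp only [map_sub, fixRed_fixLift, sub_self])
    rwa [map_sub, map_sub, sub_eq_zero, map_sub, map_sub] at this
  let φ : (FixPt (β σ) → ZMod p) →ₗ[ZMod p] (FixPt (β' σ) → ZMod p) :=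
    (AddMonoidHom.ofMapSub (fun a => fixRed p (β' σ) (R.G (fixLift a))) hsub).toZModLinearMap p
  have hφ (e : Y → ℤ) (h : permRep ℤ Y (β σ) e = e) :
      φ (fixRed p (β σ) e) = fixRed p (β' σ) (R.G e) := by
    have := hG (fixLift (fixRed p (β σ) e) - e) (by rw [map_sub, permRep_fixLift, h])
      (by rw [map_sub, fixRed_fixLift, sub_self])
    rwa [map_sub, map_sub, sub_eq_zero] at this
  -- The connecting map.
  choose c hc using R.exists_connects hp.ne_zero hd hσ
  have hcuniq (b : FixPt (β' σ) → ZMod p) (k : ℤ) (h : R.Connects p m σ b k) :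
      (c b : ZMod p) = k := by
    have := (hc b).sub h
    rw [sub_self] at this
    rw [← sub_eq_zero, ← Int.cast_sub, ZMod.intCast_zmod_eq_zero_iff_dvd]
    exact this.dvd hp hd hσ
  let θ : (FixPt (β' σ) → ZMod p) →ₗ[ZMod p] ZMod p :=
    (AddMonoidHom.ofMapSub (fun b => (c b : ZMod p)) fun b b' => by
      rw [hcuniq _ _ ((hc b).sub (hc b')), Int.cast_sub]).toZModLinearMap p
  obtain ⟨eμ, heμ, hGeμ⟩ := R.exists_of_mem μ ⟨1, by simp⟩
  have hTeμ : permRep ℤ Y (β σ) eμ = eμ := by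
    refine R.smul_right_cancel ?_
    rw [← map_smul, ← heμ, ← R.F_comm, R.permRep_mu]
  refine ⟨⟨φ, θ, fixRed p (β σ) eμ, hφ, fun z t hz hzt e he =>
    R.fixRed_eq_smul hp hσ hfree heμ hz hzt he, ?_, ?_, ?_, ?_, hcuniq⟩⟩
  · intro h0
    obtain ⟨e1, he1⟩ := exists_permNorm_eq_of_fixRed_eq_zero hp hβ hTeμ h0
    obtain ⟨y, hy⟩ := exists_eq_permRep_sub_of_permNorm_eq_zero hp.ne_zero
      (b := β' σ) (v := R.G e1) (by rw [← G_permNorm, he1, hGeμ])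
    obtain ⟨y, rfl⟩ := R.G_surj y
    obtain ⟨z, ⟨t, ht⟩, hz⟩ := R.exists_of_G_eq_zero (e1 - (permRep ℤ Y (β σ) y - y)) (by
      rw [map_sub, hy, map_sub, R.G_comm, sub_self])
    have hN : permNorm ℤ (α σ) p z = μ := by
      apply R.F_inj
      rw [F_permNorm, hz, map_smul, map_sub, permNorm_permRep_sub hβ, sub_zero, he1, heμ]
    obtain ⟨x⟩ := ‹Nonempty X›
    have h1 := hpd.trans (R.dvd_permNorm_sub ht σ p x)
    rw [hN] at h1
    have h2 : (p : ℤ) ∣ μ x := by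
      refine (dvd_add h1 ((dvd_mul_right (p : ℤ) (t * μ x)))).trans (dvd_of_eq ?_)
      ring
    exact hp'.not_isUnit ((R.isCoprime x).isUnit_of_dvd' h2 hpd)
  · refine le_antisymm (fun a ha => ?_) ?_
    · have h0 : fixRed p (β' σ) (R.G (fixLift a)) = 0 := ha
      obtain ⟨e', he'⟩ := exists_permNorm_eq_of_fixRed_eq_zero hp hβ'
        (by rw [← R.G_comm, permRep_fixLift]) h0
      obtain ⟨e1, rfl⟩ := R.G_surj e'
      obtain ⟨z, ⟨t, ht⟩, hz⟩ := R.exists_of_G_eq_zero (fixLift a - permNorm ℤ (β σ) p e1) (by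
        rw [map_sub, G_permNorm, he', sub_self])
      have hTz : permRep ℤ X (α σ) z = z := by
        apply R.F_inj
        rw [R.F_comm, hz, map_smul, map_sub, permRep_permNorm hβ, permRep_fixLift]
      have := R.fixRed_eq_smul hp hσ hfree heμ hTz ht hz
      rw [map_sub, fixRed_permNorm, sub_zero, fixRed_fixLift] at this
      rw [this]
      exact zsmul_mem (Submodule.mem_span_singleton_self _) t
    · rw [Submodule.span_singleton_le_iff_mem, LinearMap.mem_ker, hφ _ hTeμ, hGeμ, map_zero]
  · refine le_antisymm ?_ fun b hb => ?_
    · rintro _ ⟨a, rfl⟩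
      have h1 : R.Connects p m σ (φ a) 0 := by
        refine ⟨fixLift a, 0, ?_, rfl, ?_, by simp⟩
        · rw [← R.G_comm, permRep_fixLift]
        · rw [permRep_fixLift, sub_self, smul_zero, map_zero]
      exact (hcuniq _ _ h1).trans Int.cast_zero
    · obtain ⟨e, z, h1, h2, h3, h4⟩ := hc b
      have hcb : (p : ℤ) ∣ c b := (ZMod.intCast_zmod_eq_zero_iff_dvd _ _).1 hb
      obtain ⟨w, rfl⟩ := exists_eq_smul_of_dvd (v := z) (d := d) fun x => by
        have : d ∣ c b * m * μ x := by
          rw [hd]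
          exact (mul_dvd_mul_right hcb m).mul_right _
        simpa using dvd_add (h4 x) this
      have hw : permNorm ℤ (α σ) p w = 0 := by
        refine R.smul_right_cancel ?_
        rw [← map_smul, R.permNorm_eq_zero hσ h3, smul_zero]
      obtain ⟨w1, rfl⟩ := exists_eq_permRep_sub_of_permNorm_eq_zero hp.ne_zero hw
      rw [map_smul] at h3
      have h5 := R.smul_right_cancel h3
      rw [map_sub, R.F_comm] at h5
      refine ⟨fixRed p (β σ) (e - R.F w1), ?_⟩
      rw [hφ _ (by rw [map_sub]; linear_combination -h5), map_sub, R.G_F, sub_zero, h2]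
  · -- The vector `(d / p) μ - d μ r`, with `r` a transversal of the orbits, has norm zero.
    obtain ⟨r, hr, -⟩ := exists_transversal ℤ hp hα
    obtain ⟨e0, he0, hGe0⟩ := R.exists_of_mem (fun x => m * μ x - d * (μ x * r x))
      ⟨m, fun x => by simp⟩
    have hnorm : permNorm ℤ (α σ) p (fun x => m * μ x - d * (μ x * r x)) = 0 := by
      ext x
      have h (i : ℕ) : μ (((α σ)⁻¹ ^ i) x) = μ x := by
        rw [← map_inv, ← map_pow, R.mu_apply]
      have hrx := hr x (hfree x)
      rw [permNorm_apply] at hrx ⊢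
      simp only [h, Finset.sum_sub_distrib, ← Finset.mul_sum, hrx]
      simp [hd]
      ring
    obtain ⟨e, rfl⟩ := exists_eq_permRep_sub_of_permNorm_eq_zero hp.ne_zero (b := β σ) (v := e0) (by
      refine R.smul_right_cancel ?_
      rw [← map_smul, ← he0, ← F_permNorm, hnorm, map_zero, smul_zero])
    have h1 : θ (fixRed p (β' σ) (R.G e)) = (1 : ℤ) := hcuniq _ _ ⟨e, _, by
      rw [map_sub, R.G_comm, sub_eq_zero] at hGe0
      exact hGe0, rfl, he0, fun x => by simp⟩
    intro k
    exact ⟨k • fixRed p (β' σ) (R.G e), by rw [map_smul, h1]; simp⟩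

end PrimeOrder

end PermResolution

/-! ### Traces -/

/-- Additivity of the trace for an exact sequence whose outer terms are lines: the kernel of `φ`,
on which the endomorphism acts trivially, and the cokernel, on which it acts by `k`. -/
theorem trace_add_eq_trace_add_one {K A B : Type*} [Field K] [AddCommGroup A] [Module K A]
    [AddCommGroup B] [Module K B] [FiniteDimensional K A] [FiniteDimensional K B]
    {φ : A →ₗ[K] B} {θ : B →ₗ[K] K} {u : A} (hu : u ≠ 0)
    (hker : LinearMap.ker φ = Submodule.span K {u}) (hrange : LinearMap.range φ = LinearMap.ker θ)
    (hθ : Function.Surjective θ) {S : Module.End K A} {T : Module.End K B}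
    (hST : φ ∘ₗ S = T ∘ₗ φ) (hSu : S u = u) {k : K} (hT : ∀ b, θ (T b) = k * θ b) :
    LinearMap.trace K A S + k = LinearMap.trace K B T + 1 := by
  -- `ψ` is a generalised inverse of `φ`.
  obtain ⟨ψ, hψ⟩ : ∃ ψ : B →ₗ[K] A, ∀ a, φ (ψ (φ a)) = φ a := by
    obtain ⟨s, hs⟩ := φ.rangeRestrict.exists_rightInverse_of_surjective φ.range_rangeRestrict
    obtain ⟨π, hπ⟩ := (LinearMap.range φ).subtype.exists_leftInverse_of_injective
      (Submodule.ker_subtype _)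
    refine ⟨s ∘ₗ π, fun a => ?_⟩
    have h1 : π (φ a) = φ.rangeRestrict a := LinearMap.congr_fun hπ (φ.rangeRestrict a)
    have h2 := LinearMap.congr_fun hs (φ.rangeRestrict a)
    rw [LinearMap.comp_apply, h1]
    exact congrArg Subtype.val h2
  obtain ⟨v, hv⟩ := hθ 1
  obtain ⟨l, hl⟩ : ∃ l : A →ₗ[K] K, l u = 1 := by
    obtain ⟨l, hl⟩ := not_forall.1 (mt (Module.forall_dual_apply_eq_zero_iff K u).1 hu)
    exact ⟨(l u)⁻¹ • l, by simp [hl]⟩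
  have hφu : φ u = 0 := by
    rw [← LinearMap.mem_ker, hker]
    exact Submodule.mem_span_singleton_self u
  have hB (b : B) : b - φ (ψ b) = θ b • (v - φ (ψ v)) := by
    have : b - θ b • v ∈ LinearMap.range φ := by
      rw [hrange, LinearMap.mem_ker, map_sub, map_smul, hv, smul_eq_mul, mul_one, sub_self]
    obtain ⟨a, ha⟩ := this
    have h1 := hψ a
    rw [ha, map_sub, map_sub, map_smul, map_smul] at h1
    rw [smul_sub, sub_eq_sub_iff_sub_eq_sub]
    exact h1.symm
  have hA (a : A) : a - ψ (φ a) = l (a - ψ (φ a)) • u := by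
    have : a - ψ (φ a) ∈ LinearMap.ker φ := by rw [LinearMap.mem_ker, map_sub, hψ, sub_self]
    rw [hker] at this
    obtain ⟨c, hc⟩ := Submodule.mem_span_singleton.1 this
    rw [← hc, map_smul, hl, smul_eq_mul, mul_one]
  have hθφ (a : A) : θ (φ a) = 0 := by
    rw [← LinearMap.mem_ker, ← hrange]
    exact ⟨a, rfl⟩
  have hTdec : T = (φ ∘ₗ (S ∘ₗ ψ)) + θ.smulRight (T (v - φ (ψ v))) := by
    ext b
    have h1 := congrArg T (hB b)
    rw [map_sub, map_smul, sub_eq_iff_eq_add'] at h1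
    have h2 := LinearMap.congr_fun hST (ψ b)
    simp only [LinearMap.comp_apply] at h2
    rw [h1]
    simp [h2]
  have hSdec : S = ((S ∘ₗ ψ) ∘ₗ φ) + (l ∘ₗ (LinearMap.id - ψ ∘ₗ φ)).smulRight u := by
    ext a
    have h1 := congrArg S (hA a)
    rw [map_sub, map_smul, sub_eq_iff_eq_add', hSu] at h1
    rw [h1]
    simp
  have htT := congrArg (LinearMap.trace K B) hTdec
  have htS := congrArg (LinearMap.trace K A) hSdec
  rw [map_add, LinearMap.trace_smulRight] at htT htS
  rw [htT, htS, LinearMap.trace_comp_comm', hT, map_sub, hθφ, hv]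
  simp [hφu, hl]
  ring

theorem trace_permRep {K Y : Type*} [CommRing K] [Fintype Y] [DecidableEq Y] (b : Equiv.Perm Y) :
    LinearMap.trace K (Y → K) (permRep K Y b) = (Function.fixedPoints b).ncard := by
  have h : permRep K Y b = Matrix.toLin' (b⁻¹.permMatrix K) := by
    ext v y
    simp [Pi.single_apply]
  rw [h, Matrix.trace_toLin'_eq, Matrix.trace_permutation]
  congr 2
  ext y
  exact Equiv.Perm.inv_eq_iff_eq.trans eq_comm

/-! ### Normalising elements -/

/-- The permutation of the fixed points of `b` induced by a permutation `c` preserving them. -/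
def fixPerm {Y : Type*} {b c : Equiv.Perm Y} (h : ∀ y, b (c y) = c y ↔ b y = y) :
    Equiv.Perm (FixPt b) :=
  c.subtypePerm h

theorem fixRed_permRep {Y : Type*} {p : ℕ} {b c : Equiv.Perm Y}
    (h : ∀ y, b (c y) = c y ↔ b y = y) (v : Y → ℤ) :
    fixRed p b (permRep ℤ Y c v) = permRep (ZMod p) _ (fixPerm h) (fixRed p b v) := rfl

theorem preserves_fixPt {Y : Type*} {b c : Equiv.Perm Y} {k l : ℕ} (h : b * c = c * b ^ k)
    (h' : b * c⁻¹ = c⁻¹ * b ^ l) (y : Y) : b (c y) = c y ↔ b y = y := by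
  have key {c : Equiv.Perm Y} {k : ℕ} (h : b * c = c * b ^ k) {y : Y} (hy : b y = y) :
      b (c y) = c y := by
    have h1 := Equiv.Perm.congr_fun h y
    rw [Equiv.Perm.mul_apply, Equiv.Perm.mul_apply] at h1
    rw [h1, Equiv.Perm.coe_pow, Function.iterate_fixed hy]
  refine ⟨fun hy => ?_, key h⟩
  have h1 := key h' hy
  rwa [← Equiv.Perm.mul_apply c⁻¹, inv_mul_cancel, Equiv.Perm.one_apply] at h1

namespace PermResolution

variable {W X Y Y' : Type*} [Group W] {d : ℤ} {μ : X → ℤ}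
  {α : W →* Equiv.Perm X} {β : W →* Equiv.Perm Y} {β' : W →* Equiv.Perm Y'}
  {R : PermResolution d μ α β β'} {p : ℕ} {m : ℤ} {σ τ : W} {k : ℕ}

theorem permRep_mul {Z : Type*} (γ : W →* Equiv.Perm Z) (a b : W) (v : Z → ℤ) :
    permRep ℤ Z (γ (a * b)) v = permRep ℤ Z (γ a) (permRep ℤ Z (γ b) v) := by
  rw [map_mul, map_mul]
  rfl

theorem permRep_invariant {Z : Type*} (γ : W →* Equiv.Perm Z) (h : σ * τ = τ * σ ^ k)
    {v : Z → ℤ} (hv : permRep ℤ Z (γ σ) v = v) :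
    permRep ℤ Z (γ σ) (permRep ℤ Z (γ τ) v) = permRep ℤ Z (γ τ) v := by
  rw [← permRep_mul, h, permRep_mul, map_pow, map_pow, permRep_pow_of_invariant hv]

namespace FixedPointSequence

theorem φ_permRep (E : R.FixedPointSequence p m σ) (h : σ * τ = τ * σ ^ k)
    (hY : ∀ y, β σ (β τ y) = β τ y ↔ β σ y = y)
    (hY' : ∀ y, β' σ (β' τ y) = β' τ y ↔ β' σ y = y) (a : FixPt (β σ) → ZMod p) :
    E.φ (permRep (ZMod p) _ (fixPerm hY) a) = permRep (ZMod p) _ (fixPerm hY') (E.φ a) := by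
  rw [← fixRed_fixLift a, ← fixRed_permRep, E.φ_fixRed _ (permRep_fixLift a),
    E.φ_fixRed _ (permRep_invariant β h (permRep_fixLift a)), R.G_comm, fixRed_permRep]

theorem permRep_u (E : R.FixedPointSequence p m σ)
    (hY : ∀ y, β σ (β τ y) = β τ y ↔ β σ y = y) :
    permRep (ZMod p) _ (fixPerm hY) E.u = E.u := by
  obtain ⟨e, he, -⟩ := R.exists_of_mem μ ⟨1, by simp⟩
  have h1 := E.fixRed_eq μ 1 (R.permRep_mu σ) (by simp) e he
  have h2 : permRep ℤ Y (β τ) e = e := by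
    refine R.smul_right_cancel ?_
    rw [← map_smul, ← he, ← R.F_comm, R.permRep_mu]
  rw [one_smul] at h1
  rw [← h1, ← fixRed_permRep, h2]

/-- An element `τ` with `τ⁻¹ σ τ = σ ^ k` acts on `H¹(⟨σ⟩, N)` by multiplication by `k`. -/
theorem θ_permRep [Nonempty X] (E : R.FixedPointSequence p m σ) (hp : p ≠ 0) (hd : d = p * m)
    (hσ : σ ^ p = 1) (h : σ * τ = τ * σ ^ k)
    (hY' : ∀ y, β' σ (β' τ y) = β' τ y ↔ β' σ y = y) (b : FixPt (β' σ) → ZMod p) :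
    E.θ (permRep (ZMod p) _ (fixPerm hY') b) = k * E.θ b := by
  obtain ⟨c, hc⟩ := R.exists_connects hp hd hσ b
  rw [E.θ_eq b c hc]
  obtain ⟨e, z, h1, rfl, h3, h4⟩ := hc
  have key : R.Connects p m σ
      (permRep (ZMod p) _ (fixPerm hY') (fixRed p (β' σ) (R.G e))) (k * c) := by
    refine ⟨permRep ℤ Y (β τ) e,
      permRep ℤ X (α τ) (∑ i ∈ Finset.range k, (permRep ℤ X (α σ) ^ i) z), ?_, ?_, ?_, ?_⟩
    · rw [R.G_comm, permRep_invariant β' h h1]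
    · rw [R.G_comm, fixRed_permRep]
    · rw [← permRep_mul, h, permRep_mul, R.F_comm, ← map_sub, ← map_smul]
      congr 1
      have hgeom := LinearMap.congr_fun (geom_sum_mul (permRep ℤ Y (β σ)) k) e
      simp only [Module.End.mul_apply, LinearMap.sub_apply, Module.End.one_apply,
        LinearMap.sum_apply] at hgeom
      rw [map_pow, map_pow, ← hgeom, map_sum, Finset.smul_sum]
      refine Finset.sum_congr rfl fun i _ => ?_
      rw [← map_pow, ← map_pow, R.F_comm, h3, map_smul, map_pow, map_pow]
    · intro x
      obtain ⟨x, rfl⟩ := (α τ).surjective x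
      rw [permRep_apply_apply, R.mu_apply, Finset.sum_apply]
      have : (k : ℤ) * c * m * μ x = ∑ i ∈ Finset.range k, c * m * μ x := by
        simp [mul_assoc]
      rw [this, ← Finset.sum_sub_distrib]
      refine Finset.dvd_sum fun i _ => ?_
      obtain ⟨y, hy⟩ := (α (σ ^ i)).surjective x
      rw [← map_pow, ← map_pow, ← hy, permRep_apply_apply, R.mu_apply]
      exact h4 y
  rw [E.θ_eq _ _ key]
  push_cast
  rfl

end FixedPointSequence

theorem map_preserves_fixPt {Z : Type*} (γ : W →* Equiv.Perm Z) {l : ℕ} (h : σ * τ = τ * σ ^ k)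
    (h' : σ * τ⁻¹ = τ⁻¹ * σ ^ l) (y : Z) : γ σ (γ τ y) = γ τ y ↔ γ σ y = y :=
  preserves_fixPt (k := k) (l := l) (by simp only [← map_mul, ← map_pow, h])
    (by simp only [← map_inv, ← map_mul, ← map_pow, h']) y

theorem fixedPoints_fixPerm_inv {Z : Type*} {γ : W →* Equiv.Perm Z}
    (h1 : ∀ y, γ σ (γ τ y) = γ τ y ↔ γ σ y = y)
    (h2 : ∀ y, γ σ (γ τ⁻¹ y) = γ τ⁻¹ y ↔ γ σ y = y) :
    Function.fixedPoints (fixPerm h1) = Function.fixedPoints (fixPerm h2) := by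
  ext ⟨y, hy⟩
  simp only [Function.mem_fixedPoints, Function.IsFixedPt, fixPerm, Equiv.Perm.subtypePerm_apply,
    Subtype.mk.injEq, map_inv]
  exact eq_comm.trans (Equiv.Perm.inv_eq_iff_eq.symm)

/-- No resolution exists if some `σ` of prime order `p` is normalised by an element which
acts on `⟨σ⟩` by a character `k` with `k ≠ k⁻¹` modulo `p`. Permutation modules
have self-dual characters, and the multiplicities of `k` and `k⁻¹` differ in `H¹(⟨σ⟩, N)`. -/
theorem false_of_character [Finite Y] [Finite Y'] [Nonempty X] (R : PermResolution d μ α β β')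
    (hp : p.Prime) (hd : d = p * m) (hσ : σ ^ p = 1) (hfree : ∀ x, α σ x ≠ x) {l : ℕ}
    (h : σ * τ = τ * σ ^ k) (h' : σ * τ⁻¹ = τ⁻¹ * σ ^ l) (hkl : (k : ZMod p) ≠ l) : False := by
  classical
  have := Fintype.ofFinite Y
  have := Fintype.ofFinite Y'
  have : Fact p.Prime := ⟨hp⟩
  obtain ⟨E⟩ := R.nonempty_fixedPointSequence hp hd hσ hfree
  have trace_eq {τ : W} {k l : ℕ} (h : σ * τ = τ * σ ^ k) (h' : σ * τ⁻¹ = τ⁻¹ * σ ^ l)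
      (hY : ∀ y, β σ (β τ y) = β τ y ↔ β σ y = y)
      (hY' : ∀ y, β' σ (β' τ y) = β' τ y ↔ β' σ y = y) :
      ((Function.fixedPoints (fixPerm hY)).ncard : ZMod p) + k =
        (Function.fixedPoints (fixPerm hY')).ncard + 1 := by
    rw [← trace_permRep, ← trace_permRep]
    refine trace_add_eq_trace_add_one E.u_ne E.ker_φ E.range_φ E.θ_surj ?_ (E.permRep_u hY)
      (E.θ_permRep hp.ne_zero hd hσ h hY')
    exact LinearMap.ext fun a => E.φ_permRep h hY hY' a
  have h'' : σ * τ⁻¹⁻¹ = τ⁻¹⁻¹ * σ ^ k := by rwa [inv_inv]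
  have e1 := trace_eq h h' (map_preserves_fixPt β h h') (map_preserves_fixPt β' h h')
  have e2 := trace_eq h' h'' (map_preserves_fixPt β h' h'') (map_preserves_fixPt β' h' h'')
  rw [fixedPoints_fixPerm_inv (map_preserves_fixPt β h h') (map_preserves_fixPt β h' h''),
    fixedPoints_fixPerm_inv (map_preserves_fixPt β' h h') (map_preserves_fixPt β' h' h'')] at e1
  exact hkl (add_left_cancel (e1.trans e2.symm))

end PermResolution

/-! ### Counting orbits for an odd prime -/

theorem fixPerm_pow_eq_one {Y : Type*} {b c : Equiv.Perm Y} (h : ∀ y, b (c y) = c y ↔ b y = y)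
    {n : ℕ} (hn : c ^ n = 1) : fixPerm h ^ n = 1 := by
  have key (n : ℕ) (y : FixPt b) : (((fixPerm h) ^ n) y : Y) = (c ^ n) y := by
    induction n with
    | zero => rfl
    | succ n ih =>
      rw [pow_succ', pow_succ', Equiv.Perm.mul_apply, Equiv.Perm.mul_apply, ← ih]
      rfl
  ext y
  rw [key, hn]
  rfl

theorem fixLift_permRep {Y : Type*} {p : ℕ} {b c : Equiv.Perm Y}
    (h : ∀ y, b (c y) = c y ↔ b y = y) (a : FixPt b → ZMod p) :
    fixLift (permRep (ZMod p) _ (fixPerm h) a) = permRep ℤ Y c (fixLift a) := by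
  ext y
  obtain ⟨y, rfl⟩ := c.surjective y
  rw [permRep_apply_apply]
  by_cases hy : b y = y
  · have hy' := (h y).2 hy
    rw [fixLift, fixLift, dif_pos hy, dif_pos hy']
    congr 1
    exact permRep_apply_apply (fixPerm h) a ⟨y, hy⟩
  · have hy' := mt (h y).1 hy
    rw [fixLift, fixLift, dif_neg hy, dif_neg hy']

/-- The orbits of a permutation of odd order have odd length, so their number has the parity of
the number of points. -/
theorem finrank_invariants_mod_two {K Y : Type*} [Field K] [Finite Y] {c : Equiv.Perm Y} {p : ℕ}
    (hp : Odd p) (hc : c ^ p = 1) :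
    Module.finrank K (LinearMap.ker (permRep K Y c - 1)) % 2 = Nat.card Y % 2 := by
  classical
  have := Fintype.ofFinite Y
  let Γ := Subgroup.zpowers c
  let Ω := MulAction.orbitRel.Quotient Γ Y
  have : Fintype Ω := Fintype.ofFinite Ω
  have hrange : LinearMap.range (LinearMap.funLeft K K (Quotient.mk (MulAction.orbitRel Γ Y))) =
      LinearMap.ker (permRep K Y c - 1) := by
    ext v
    rw [LinearMap.mem_ker, LinearMap.sub_apply, Module.End.one_apply, sub_eq_zero]
    constructor
    · rintro ⟨f, rfl⟩
      ext y
      rw [permRep_apply, LinearMap.funLeft_apply, LinearMap.funLeft_apply]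
      congr 1
      exact Quotient.sound ⟨⟨c⁻¹, inv_mem (Subgroup.mem_zpowers c)⟩, rfl⟩
    · intro hv
      refine ⟨Quotient.lift v ?_, rfl⟩
      rintro _ y ⟨⟨g, hg⟩, rfl⟩
      obtain ⟨n, rfl⟩ := mem_powers_iff_mem_zpowers.2 hg
      have := congrFun (permRep_pow_of_invariant hv n) ((c ^ n) y)
      rw [← map_pow, permRep_apply_apply] at this
      exact this.symm
  rw [← hrange, LinearMap.finrank_range_of_inj (LinearMap.funLeft_injective_of_surjective K K _
    Quotient.mk_surjective), Module.finrank_fintype_fun_eq_card, Nat.card_eq_fintype_card,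
    Fintype.card_congr (MulAction.selfEquivSigmaOrbits Γ Y), Fintype.card_sigma,
    Finset.sum_nat_mod, Finset.sum_congr rfl fun ω _ => ?_, Finset.sum_const, Finset.card_univ,
    smul_eq_mul, mul_one]
  have h1 := MulAction.card_orbit_mul_card_stabilizer_eq_card_group Γ ω.out
  have h2 : Fintype.card Γ ∣ p := by
    rw [Fintype.card_zpowers]
    exact orderOf_dvd_of_pow_eq_one hc
  exact Nat.odd_iff.1 (hp.of_dvd_nat ((Dvd.intro _ h1).trans h2))

namespace PermResolution

variable {W X Y Y' : Type*} [Group W] {d : ℤ} {μ : X → ℤ}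
  {α : W →* Equiv.Perm X} {β : W →* Equiv.Perm Y} {β' : W →* Equiv.Perm Y'}
  {R : PermResolution d μ α β β'} {p : ℕ} {m : ℤ} {σ π : W}

/-- If `F z / d` is a coboundary of an element with a fixed point on `X`, then the class of `z` in
`H¹` is trivial. -/
theorem dvd_of_fixed (R : PermResolution d μ α β β') {w : W} (hp : p ≠ 0) (hw : w ^ p = 1) {x : X}
    (hx : α w x = x) {z : X → ℤ} {t : ℤ} (hz : ∀ x, d ∣ z x - t * μ x) {e : Y → ℤ}
    (h : R.F z = d • (permRep ℤ Y (β w) e - e)) : d ∣ t := by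
  have h1 := congrFun (R.permNorm_eq_zero hw h) x
  rw [permNorm_apply_of_fixed hx, Pi.zero_apply, mul_eq_zero] at h1
  have h2 := hz x
  rw [h1.resolve_left (by exact_mod_cast hp), zero_sub, dvd_neg] at h2
  exact (R.isCoprime x).symm.dvd_of_dvd_mul_right h2

/-- The cohomology `H¹(⟨σ, π⟩, N)` vanishes when `⟨σ, π⟩` is generated by elements with fixed
points on `X`. Hence `θ` vanishes on invariants of `π`. -/
theorem FixedPointSequence.θ_eq_zero (E : R.FixedPointSequence p m σ) (hp : p ≠ 0)
    (hσ : σ ^ p = 1) (hπ : π ^ p = 1) (hcomm : Commute σ π) {x₁ x₂ : X}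
    (h₁ : α π x₁ = x₁) (h₂ : α σ x₂ = α π x₂) {b : Y' → ℤ}
    (hbσ : permRep ℤ Y' (β' σ) b = b) (hbπ : permRep ℤ Y' (β' π) b = b) :
    E.θ (fixRed p (β' σ) b) = 0 := by
  obtain ⟨e, rfl⟩ := R.G_surj b
  have hzero {w : W} {x : X} (hw : w ^ p = 1) (hx : α w x = x)
      (hbw : permRep ℤ Y' (β' w) (R.G e) = R.G e) :
      ∃ z, R.F z = d • (permRep ℤ Y (β w) e - e) ∧ ∀ x, d ∣ z x := by
    obtain ⟨z, ⟨t, ht⟩, hz⟩ := R.exists_of_G_eq_zero (permRep ℤ Y (β w) e - e) (by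
      rw [map_sub, R.G_comm, hbw, sub_self])
    refine ⟨z, hz, fun y => ?_⟩
    simpa using dvd_add (ht y) ((R.dvd_of_fixed hp hw hx ht hz).mul_right (μ y))
  obtain ⟨z₁, hz₁, hdz₁⟩ := hzero hπ h₁ hbπ
  have hfix : α (σ⁻¹ * π) x₂ = x₂ := by
    rw [map_mul, map_inv, Equiv.Perm.mul_apply, Equiv.Perm.inv_eq_iff_eq, h₂]
  obtain ⟨z₂, hz₂, hdz₂⟩ := hzero (w := σ⁻¹ * π)
    (by rw [hcomm.inv_left.mul_pow, inv_pow, hσ, hπ, inv_one, one_mul]) hfix (by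
      have h := congrArg (permRep ℤ Y' (β' σ⁻¹)) hbσ
      rw [← permRep_mul, inv_mul_cancel, map_one, map_one, Module.End.one_apply] at h
      rw [permRep_mul, hbπ, ← h])
  rw [← Int.cast_zero]
  refine E.θ_eq _ _ ⟨e, z₁ - permRep ℤ X (α σ) z₂, hbσ, rfl, ?_, fun x => ?_⟩
  · rw [map_sub, R.F_comm, hz₁, hz₂, map_smul, map_sub, ← permRep_mul, mul_inv_cancel_left,
      ← smul_sub]
    congr 1
    abel
  · rw [zero_mul, zero_mul, sub_zero]
    exact dvd_sub (hdz₁ x) (hdz₂ _)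

/-- No resolution exists if two commuting elements `σ` and `π` of odd prime order `p` act on `X`
in such a way that `σ` has no fixed point while `π` and `σ⁻¹ π` have fixed points. The two middle
terms of the sequence of `σ` have the same dimension, and those of the sequence of its
`π`-invariants have dimensions differing by one, which contradicts the parity of the number of
orbits. -/
theorem false_of_bicyclic [Finite Y] [Finite Y'] (R : PermResolution d μ α β β')
    (hp : p.Prime) (hodd : Odd p) (hd : d = p * m) (hσ : σ ^ p = 1) (hfree : ∀ x, α σ x ≠ x)
    (hπ : π ^ p = 1) (hcomm : Commute σ π) {x₁ x₂ : X} (h₁ : α π x₁ = x₁)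
    (h₂ : α σ x₂ = α π x₂) : False := by
  have : Nonempty X := ⟨x₁⟩
  have : Fact p.Prime := ⟨hp⟩
  have := Fintype.ofFinite Y
  have := Fintype.ofFinite Y'
  obtain ⟨E⟩ := R.nonempty_fixedPointSequence hp hd hσ hfree
  have hc : σ * π = π * σ ^ 1 := by rw [pow_one, hcomm.eq]
  have hc' : σ * π⁻¹ = π⁻¹ * σ ^ 1 := by rw [pow_one, hcomm.inv_right.eq]
  have hY := map_preserves_fixPt β hc hc'
  have hY' := map_preserves_fixPt β' hc hc'
  set S := permRep (ZMod p) _ (fixPerm hY) with hS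
  set T := permRep (ZMod p) _ (fixPerm hY') with hT
  have hφST (a) : E.φ (S a) = T (E.φ a) := E.φ_permRep hc hY hY' a
  have hφu : E.φ E.u = 0 := by
    rw [← LinearMap.mem_ker, E.ker_φ]
    exact Submodule.mem_span_singleton_self _
  have hθ (b) (hb : T b = b) : E.θ b = 0 := by
    rw [← fixRed_fixLift b]
    refine E.θ_eq_zero hp.ne_zero hσ hπ hcomm h₁ h₂ (permRep_fixLift b) ?_
    rw [← fixLift_permRep hY', ← hT, hb]
  -- The class of `μ / d` is not a coboundary for `π`.
  have hu (a) : S a - a ≠ E.u := by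
    intro ha
    have hb : T (E.φ a) = E.φ a := by
      rw [← hφST, ← sub_eq_zero, ← map_sub, ha, hφu]
    have hinv : permRep ℤ Y (β σ) (fixLift a) = fixLift a := permRep_fixLift a
    obtain ⟨c', hc'⟩ := exists_permNorm_eq_of_fixRed_eq_zero hp (b := β' σ)
      (v := R.G (fixLift a) - fixLift (E.φ a)) (by rw [← map_pow, hσ, map_one])
      (by rw [map_sub, ← R.G_comm, hinv, permRep_fixLift])
      (by rw [map_sub, ← E.φ_fixRed _ hinv, fixRed_fixLift, fixRed_fixLift, sub_self])
    obtain ⟨c, rfl⟩ := R.G_surj c'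
    -- `f` lifts `a`, and `G f` is invariant under both `σ` and `π`.
    set f := fixLift a - permNorm ℤ (β σ) p c with hf
    have hfσ : permRep ℤ Y (β σ) f = f := by
      rw [hf, map_sub, hinv, permRep_permNorm (by rw [← map_pow, hσ, map_one])]
    have hGf : R.G f = fixLift (E.φ a) := by
      rw [hf, map_sub, G_permNorm, hc', sub_sub_cancel]
    obtain ⟨z, ⟨t, ht⟩, hz⟩ := R.exists_of_G_eq_zero (permRep ℤ Y (β π) f - f) (by
      rw [map_sub, R.G_comm, hGf, ← fixLift_permRep hY', ← hT, hb, sub_self])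
    have hzσ : permRep ℤ X (α σ) z = z := by
      apply R.F_inj
      rw [R.F_comm, hz, map_smul, map_sub, permRep_invariant β hc hfσ, hfσ]
    have h3 := E.fixRed_eq z t hzσ ht _ hz
    have h4 : fixRed p (β σ) f = a := by
      rw [hf, map_sub, fixRed_permNorm, sub_zero, fixRed_fixLift]
    rw [map_sub, fixRed_permRep hY, h4, ← hS, ha] at h3
    have h5 : (p : ℤ) ∣ t :=
      (Dvd.intro m hd.symm).trans (R.dvd_of_fixed hp.ne_zero hπ h₁ ht hz)
    have h6 : (t : ZMod p) = 0 := (ZMod.intCast_zmod_eq_zero_iff_dvd _ _).2 h5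
    rw [← Int.cast_smul_eq_zsmul (ZMod p), h6, zero_smul] at h3
    exact E.u_ne h3
  have hSu : S E.u = E.u := E.permRep_u hY
  -- Dimension count for the whole sequence.
  have dim1 : Nat.card (FixPt (β σ)) = Nat.card (FixPt (β' σ)) := by
    classical
    have e1 := E.φ.finrank_range_add_finrank_ker
    have e2 := E.θ.finrank_range_add_finrank_ker
    rw [E.ker_φ, finrank_span_singleton E.u_ne, Module.finrank_fintype_fun_eq_card] at e1
    rw [LinearMap.range_eq_top.2 E.θ_surj, finrank_top, Module.finrank_self, ← E.range_φ,
      Module.finrank_fintype_fun_eq_card] at e2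
    rw [Nat.card_eq_fintype_card, Nat.card_eq_fintype_card]
    omega
  -- Dimension count for the invariants of `π`.
  have dim2 : Module.finrank (ZMod p) (LinearMap.ker (S - 1)) =
      Module.finrank (ZMod p) (LinearMap.ker (T - 1)) + 1 := by
    have memS {a} : a ∈ LinearMap.ker (S - 1) ↔ S a = a := by
      rw [LinearMap.mem_ker, LinearMap.sub_apply, Module.End.one_apply, sub_eq_zero]
    have memT {b} : b ∈ LinearMap.ker (T - 1) ↔ T b = b := by
      rw [LinearMap.mem_ker, LinearMap.sub_apply, Module.End.one_apply, sub_eq_zero]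
    let ψ := E.φ.restrict (p := LinearMap.ker (S - 1)) (q := LinearMap.ker (T - 1))
      fun a ha => memT.2 (by rw [← hφST, memS.1 ha])
    have hsurj : LinearMap.range ψ = ⊤ := by
      rw [LinearMap.range_eq_top]
      rintro ⟨b, hb⟩
      have hb0 : b ∈ LinearMap.range E.φ := by
        rw [E.range_φ, LinearMap.mem_ker, hθ b (memT.1 hb)]
      obtain ⟨a, rfl⟩ := hb0
      refine ⟨⟨a, memS.2 ?_⟩, rfl⟩
      have h0 : S a - a ∈ LinearMap.ker E.φ := by
        rw [LinearMap.mem_ker, map_sub, hφST, memT.1 hb, sub_self]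
      rw [E.ker_φ] at h0
      obtain ⟨k, hk⟩ := Submodule.mem_span_singleton.1 h0
      rcases eq_or_ne k 0 with rfl | hk0
      · rw [← sub_eq_zero, ← hk, zero_smul]
      · refine absurd ?_ (hu (k⁻¹ • a))
        rw [map_smul, ← smul_sub, ← hk, smul_smul, inv_mul_cancel₀ hk0, one_smul]
    have hker : LinearMap.ker ψ = Submodule.span _ {⟨E.u, memS.2 hSu⟩} := by
      ext ⟨a, ha⟩
      have : a ∈ LinearMap.ker E.φ ↔ a ∈ Submodule.span (ZMod p) {E.u} := by rw [E.ker_φ]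
      rw [LinearMap.mem_ker, Submodule.mem_span_singleton] at this
      rw [LinearMap.mem_ker, Submodule.mem_span_singleton, Subtype.ext_iff]
      exact this.trans (exists_congr fun k => by rw [Subtype.ext_iff]; rfl)
    have e := ψ.finrank_range_add_finrank_ker
    rw [hsurj, hker, finrank_top, finrank_span_singleton (by
      intro h; exact E.u_ne (congrArg Subtype.val h))] at e
    exact e.symm
  have par1 := finrank_invariants_mod_two (K := ZMod p) hodd
    (fixPerm_pow_eq_one hY (by rw [← map_pow, hπ, map_one]))
  have par2 := finrank_invariants_mod_two (K := ZMod p) hodd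
    (fixPerm_pow_eq_one hY' (by rw [← map_pow, hπ, map_one]))
  rw [← hS, dim1] at par1
  rw [← hT] at par2
  omega

end PermResolution

/-! ### The Klein four-group -/

theorem permNorm_two_apply {K Y : Type*} [CommRing K] {b : Equiv.Perm Y} (v : Y → K) (y : Y) :
    permNorm K b 2 v y = v y + permRep K Y b v y := by
  simp [permNorm, Finset.sum_range_succ]

/-- For commuting involutions `a` and `b`, there is a function, invariant under `a b`, whose values
at `y` and `a y` add up to `1` for all points `y` fixed by neither `a` nor `b`. -/
theorem exists_transversal_of_involutions {Y : Type*} {a b : Equiv.Perm Y} (ha : a ^ 2 = 1)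
    (hb : b ^ 2 = 1) (hab : Commute a b) :
    ∃ r : Y → ℤ, permRep ℤ Y (a * b) r = r ∧
      ∀ y, a y ≠ y → b y ≠ y → r y + permRep ℤ Y a r y = 1 := by
  let s : Setoid Y := Equiv.Perm.SameCycle.setoid (a * b)
  have hconj : a * (a * b) * a⁻¹ = a * b := by
    rw [hab.eq, mul_assoc, mul_assoc, mul_inv_cancel, mul_one, hab.eq]
  let c : Equiv.Perm (Quotient s) := Quotient.congr a fun x y => by
    change (a * b).SameCycle x y ↔ (a * b).SameCycle (a x) (a y)
    conv_rhs => rw [← hconj, Equiv.Perm.sameCycle_conj]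
    simp
  have hc : c ^ 2 = 1 := by
    ext q
    induction q using Quotient.inductionOn with | h y => ?_
    change Quotient.mk s ((a ^ 2) y) = Quotient.mk s y
    rw [ha]
    rfl
  obtain ⟨r, hr, -⟩ := exists_transversal ℤ Nat.prime_two hc
  refine ⟨fun y => r (Quotient.mk s y), ?_, fun y hay hby => ?_⟩
  · ext y
    rw [permRep_apply]
    congr 1
    exact Quotient.sound (show (a * b).SameCycle _ y from ⟨1, by simp⟩)
  · rw [← hr (Quotient.mk s y), permNorm_two_apply]
    · rfl
    · intro h
      obtain ⟨k, hk⟩ : (a * b).SameCycle (a y) y := Quotient.exact h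
      have h2 : (a * b) ^ (2 : ℤ) = 1 := by
        rw [zpow_ofNat, hab.mul_pow, ha, hb, one_mul]
      rcases Int.even_or_odd' k with ⟨j, rfl | rfl⟩
      · rw [zpow_mul, h2, one_zpow] at hk
        exact hay hk
      · rw [zpow_add, zpow_mul, h2, one_zpow, one_mul, zpow_one, hab.eq, Equiv.Perm.mul_apply,
          ← Equiv.Perm.mul_apply a, ← pow_two, ha] at hk
        exact hby hk

namespace PermResolution

variable {W X Y Y' : Type*} [Group W] {d : ℤ} {μ : X → ℤ}
  {α : W →* Equiv.Perm X} {β : W →* Equiv.Perm Y} {β' : W →* Equiv.Perm Y'}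
  {R : PermResolution d μ α β β'} {m : ℤ} {g₁ g₂ : W}

/-- Half of the vector `F v`, for `v = μ` on the fixed points of `g₁` and `v = 0` elsewhere,
represents a class in `H¹(⟨g₁, g₂⟩, ℚ^Y / ℤ^Y)` which is locally trivial, hence a coboundary. -/
theorem exists_permRep_sub_eq (R : PermResolution d μ α β β') (hd : d = 2 * m)
    (hg₁ : g₁ ^ 2 = 1) (hg₂ : g₂ ^ 2 = 1) (hcomm : Commute g₁ g₂)
    (hfree : ∀ x, α g₁ x = x → α g₂ x ≠ x) {v : X → ℤ} (hv : ∀ x, α g₁ x = x → v x = μ x)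
    (hv0 : ∀ x, α g₁ x ≠ x → v x = 0) :
    ∃ e r, permRep ℤ Y (β g₁) e - e = R.F v + (2 : ℤ) • r ∧
      permRep ℤ Y (β g₂) e = permRep ℤ Y (β g₁) e := by
  have sqα {g : W} (h : g ^ 2 = 1) : α g ^ 2 = 1 := by rw [← map_pow, h, map_one]
  have sqβ {g : W} (h : g ^ 2 = 1) : β g ^ 2 = 1 := by rw [← map_pow, h, map_one]
  -- `v` is invariant under `g₁` and `g₂`.
  have hfix₂ (x : X) : α g₁ (α g₂ x) = α g₂ x ↔ α g₁ x = x := by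
    rw [← Equiv.Perm.mul_apply, ← map_mul, hcomm.eq, map_mul, Equiv.Perm.mul_apply,
      EmbeddingLike.apply_eq_iff_eq]
  have hinv {g : W} (hg : ∀ x, α g₁ (α g x) = α g x ↔ α g₁ x = x) :
      permRep ℤ X (α g) v = v := by
    ext x
    obtain ⟨x, rfl⟩ := (α g).surjective x
    rw [permRep_apply_apply]
    by_cases hx : α g₁ x = x
    · rw [hv x hx, hv _ ((hg x).2 hx), R.mu_apply]
    · rw [hv0 x hx, hv0 _ (mt (hg x).1 hx)]
  have hinv₁ := hinv (g := g₁) fun x => by rw [EmbeddingLike.apply_eq_iff_eq]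
  have hinv₂ := hinv hfix₂
  -- `F μ` is even, because `μ / 2` belongs to the lattice.
  obtain ⟨e₀, he₀, -⟩ := R.exists_of_mem (m • μ) ⟨m, by simp⟩
  have hm : m ≠ 0 := by
    rintro rfl
    exact R.d_ne (by simp [hd])
  have hFμ : R.F μ = (2 : ℤ) • e₀ := by
    refine smul_right_injective (Y → ℤ) hm ?_
    change m • R.F μ = m • (2 : ℤ) • e₀
    rw [← map_smul, he₀, hd, smul_smul, mul_comm]
  have heven {g : W} {w : X → ℤ} {y : Y} (hy : β g y = y) :
      (2 : ℤ) ∣ R.F (permNorm ℤ (α g) 2 w) y := by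
    rw [F_permNorm, permNorm_apply_of_fixed hy]
    exact dvd_mul_right _ _
  have heven₁ (y : Y) (hy : β g₁ y = y) : (2 : ℤ) ∣ R.F v y := by
    obtain ⟨r, hr, hr0⟩ := exists_transversal ℤ Nat.prime_two (sqα hg₁)
    have : v = μ - permNorm ℤ (α g₁) 2 (μ * r) := by
      ext x
      have hμ : permRep ℤ X (α g₁) (μ * r) x = μ x * permRep ℤ X (α g₁) r x := by
        have := congrFun (R.permRep_mu g₁) x
        rw [permRep_apply] at this
        rw [permRep_apply, Pi.mul_apply, this, permRep_apply]
      rw [Pi.sub_apply, permNorm_two_apply, hμ]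
      by_cases hx : α g₁ x = x
      · have h1 : permRep ℤ X (α g₁) r x = 0 := by
          rw [permRep_apply, (α g₁).symm_apply_eq.2 hx.symm, hr0 x hx]
        rw [hv x hx, h1]
        simp [hr0 x hx]
      · have h1 := hr x hx
        rw [permNorm_two_apply] at h1
        rw [hv0 x hx, Pi.mul_apply, ← mul_add, h1]
        simp
    rw [this, map_sub, Pi.sub_apply, hFμ]
    exact dvd_sub ⟨e₀ y, rfl⟩ (heven hy)
  have heven₂ (y : Y) (hy : β g₂ y = y) : (2 : ℤ) ∣ R.F v y := by
    obtain ⟨w, rfl⟩ := exists_permNorm_eq Nat.prime_two (sqα hg₂) hinv₂ fun x hx => by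
      rw [hv0 x fun h => hfree x h hx]
      exact dvd_zero _
    exact heven hy
  have hβ : Commute (β g₁) (β g₂) := hcomm.map β
  obtain ⟨r, hr₃, hr⟩ := exists_transversal_of_involutions (sqβ hg₁) (sqβ hg₂) hβ
  have hF₁ : permRep ℤ Y (β g₁) (R.F v) = R.F v := by rw [← R.F_comm, hinv₁]
  have hF₂ : permRep ℤ Y (β g₂) (R.F v) = R.F v := by rw [← R.F_comm, hinv₂]
  have hmul (b : Equiv.Perm Y) (f g : Y → ℤ) :
      permRep ℤ Y b (f * g) = permRep ℤ Y b f * permRep ℤ Y b g := rfl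
  have h₁₂ : permRep ℤ Y (β g₂) r = permRep ℤ Y (β g₁) r := by
    conv_rhs => rw [← hr₃]
    rw [← Module.End.mul_apply, ← map_mul, ← mul_assoc, ← pow_two, sqβ hg₁, one_mul]
  have hdiv (y : Y) : (2 : ℤ) ∣
      (permRep ℤ Y (β g₁) (R.F v * r) - R.F v * r - R.F v) y := by
    rw [hmul, hF₁]
    simp only [Pi.sub_apply, Pi.mul_apply]
    by_cases h1 : β g₁ y = y
    · exact dvd_sub (dvd_sub ((heven₁ y h1).mul_right _) ((heven₁ y h1).mul_right _)) (heven₁ y h1)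
    by_cases h2 : β g₂ y = y
    · exact dvd_sub (dvd_sub ((heven₂ y h2).mul_right _) ((heven₂ y h2).mul_right _)) (heven₂ y h2)
    refine ⟨-(R.F v y * r y), ?_⟩
    have := hr y h1 h2
    linear_combination R.F v y * this
  obtain ⟨f, hf⟩ := exists_eq_smul_of_dvd hdiv
  refine ⟨R.F v * r, f, ?_, ?_⟩
  · rw [← hf]
    abel
  · rw [hmul, hmul, hF₁, hF₂, h₁₂]

/-- No resolution exists if `d` is even and there are commuting involutions `g₁` and `g₂` without
common fixed points on `X`, such that each of `g₁`, `g₂` and `g₁ g₂` has a fixed point on `X`. -/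
theorem false_of_four_group (R : PermResolution d μ α β β') (hd : d = 2 * m)
    (hg₁ : g₁ ^ 2 = 1) (hg₂ : g₂ ^ 2 = 1) (hcomm : Commute g₁ g₂)
    (hfree : ∀ x, α g₁ x = x → α g₂ x ≠ x) {x₁ x₂ x₃ : X} (h₁ : α g₁ x₁ = x₁)
    (h₂ : α g₂ x₂ = x₂) (h₃ : α g₁ x₃ = α g₂ x₃) : False := by
  classical
  let v : X → ℤ := fun x => if α g₁ x = x then μ x else 0
  obtain ⟨e₀, r₀, he₀, he₀'⟩ := R.exists_permRep_sub_eq hd hg₁ hg₂ hcomm hfree (v := v)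
    (fun x hx => if_pos hx) (fun x hx => if_neg hx)
  have hsq : permRep ℤ X (α g₁) v = v := by
    ext x
    obtain ⟨x, rfl⟩ := (α g₁).surjective x
    rw [permRep_apply_apply]
    simp only [v, EmbeddingLike.apply_eq_iff_eq, R.mu_apply]
  -- The image of `e₀` is invariant modulo `2`, and can be lifted to an honest invariant.
  obtain ⟨t, q', ht, htq⟩ := exists_invariant_add_smul
    (Relation.EqvGen.setoid fun x y => y = β' g₁ x ∨ y = β' g₂ x) 2 (R.G e₀) (by
      have hG (x : Y') : (2 : ℤ) ∣ R.G (permRep ℤ Y (β g₁) e₀) x - R.G e₀ x := by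
        rw [← Pi.sub_apply, ← map_sub, he₀, map_add, R.G_F, zero_add, map_smul]
        exact ⟨R.G r₀ x, rfl⟩
      intro x y h
      induction h with
      | rel x y h =>
        rcases h with rfl | rfl
        · have := hG (β' g₁ x)
          rwa [R.G_comm, permRep_apply_apply] at this
        · have := hG (β' g₂ x)
          rwa [← he₀', R.G_comm, permRep_apply_apply] at this
      | refl x => simp
      | symm x y _ ih => rwa [dvd_sub_comm]
      | trans x y z _ _ ih ih' => simpa using dvd_add ih ih')
  obtain ⟨q, rfl⟩ := R.G_surj q'
  have ht₁ : permRep ℤ Y' (β' g₁) t = t := by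
    ext y
    obtain ⟨y, rfl⟩ := (β' g₁).surjective y
    rw [permRep_apply_apply]
    exact ht _ _ (Relation.EqvGen.rel _ _ (Or.inl rfl))
  have ht₂ : permRep ℤ Y' (β' g₂) t = t := by
    ext y
    obtain ⟨y, rfl⟩ := (β' g₂).surjective y
    rw [permRep_apply_apply]
    exact ht _ _ (Relation.EqvGen.rel _ _ (Or.inr rfl))
  set e := e₀ - (2 : ℤ) • q with he
  have hGe : R.G e = t := by rw [he, map_sub, map_smul, htq, add_sub_cancel_right]
  -- The values of the resulting cocycle of `N`, and their halves modulo `v`.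
  have key {w : W} {k : ℤ} {r : Y → ℤ} (hw : permRep ℤ Y' (β' w) t = t)
      (hr : permRep ℤ Y (β w) e - e = k • R.F v + (2 : ℤ) • r) :
      ∃ z s, R.F z = d • r ∧ R.F (k • d • v + (2 : ℤ) • z) = d • (permRep ℤ Y (β w) e - e) ∧
        ∀ x, d ∣ z x - s * μ x := by
    have h0 : R.G r = 0 := by
      have h1 := congrArg R.G hr
      rw [map_sub, R.G_comm, hGe, hw, sub_self, map_add, map_smul, R.G_F, smul_zero, zero_add,
        map_smul] at h1
      exact (smul_eq_zero_iff_right two_ne_zero).1 h1.symm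
    obtain ⟨z, ⟨s, hs⟩, hz⟩ := R.exists_of_G_eq_zero r h0
    refine ⟨z, s, hz, ?_, hs⟩
    rw [hr, map_add, map_smul, map_smul, map_smul, hz, smul_add, smul_comm d k, smul_comm d 2]
  have val {w : W} {z' : X → ℤ} {x : X} (hw : w ^ 2 = 1) (hx : α w x = x)
      (h : R.F z' = d • (permRep ℤ Y (β w) e - e)) : z' x = 0 := by
    have h1 := congrFun (R.permNorm_eq_zero hw h) x
    rw [permNorm_apply_of_fixed hx, Pi.zero_apply, mul_eq_zero] at h1
    exact h1.resolve_left (by norm_num)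
  have cancel {t : ℤ} {x : X} (h : d ∣ t * μ x) : d ∣ t :=
    (R.isCoprime x).symm.dvd_of_dvd_mul_right h
  have hp₃ : permRep ℤ Y (β (g₁ * g₂)) e₀ = e₀ := by
    rw [permRep_mul, he₀', ← permRep_mul, ← pow_two, hg₁, map_one, map_one]
    rfl
  obtain ⟨z₁, s₁, hz₁, hF₁, hs₁⟩ := key (w := g₁) (k := 1)
    (r := r₀ - (permRep ℤ Y (β g₁) q - q)) ht₁ (by
      rw [he, map_sub, map_smul, one_smul, smul_sub, smul_sub]
      linear_combination he₀)
  obtain ⟨z₂, s₂, hz₂, hF₂, hs₂⟩ := key (w := g₂) (k := 1)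
    (r := r₀ - (permRep ℤ Y (β g₂) q - q)) ht₂ (by
      rw [he, map_sub, map_smul, one_smul, smul_sub, smul_sub, he₀']
      linear_combination he₀)
  obtain ⟨z₃, s₃, hz₃, hF₃, hs₃⟩ := key (w := g₁ * g₂) (k := 0)
    (r := - (permRep ℤ Y (β (g₁ * g₂)) q - q)) (by rw [permRep_mul, ht₂, ht₁]) (by
      rw [he, map_sub, map_smul, hp₃, zero_smul, smul_neg, smul_sub]
      abel)
  have hfix₃ : α (g₁ * g₂) x₃ = x₃ := by
    rw [map_mul, Equiv.Perm.mul_apply, ← h₃, ← Equiv.Perm.mul_apply, ← map_mul, ← pow_two, hg₁,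
      map_one, Equiv.Perm.one_apply]
  have v₁ := val hg₁ h₁ hF₁
  have v₂ := val hg₂ h₂ hF₂
  have v₃ := val (by rw [hcomm.mul_pow, hg₁, hg₂, one_mul]) hfix₃ hF₃
  have hvx₁ : v x₁ = μ x₁ := if_pos h₁
  have hvx₂ : v x₂ = 0 := if_neg fun h => hfree x₂ h h₂
  simp only [Pi.add_apply, Pi.smul_apply, smul_eq_mul, hvx₁, hvx₂] at v₁ v₂ v₃
  have d₁ : d ∣ s₁ + m := by
    refine cancel (x := x₁) ?_
    have h := hs₁ x₁
    rw [show z₁ x₁ = -m * μ x₁ by rw [hd] at v₁; linarith, ← sub_mul] at h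
    rw [← dvd_neg]
    exact h.trans (dvd_of_eq (by ring))
  have d₂ : d ∣ s₂ := by
    refine cancel (x := x₂) ?_
    have h := hs₂ x₂
    rwa [show z₂ x₂ = 0 by linarith, zero_sub, dvd_neg] at h
  have d₃ : d ∣ s₃ := by
    refine cancel (x := x₃) ?_
    have h := hs₃ x₃
    rwa [show z₃ x₃ = 0 by linarith, zero_sub, dvd_neg] at h
  -- The cocycle relation for `g₁ g₂`.
  have hrel : z₃ = d • v + permRep ℤ X (α g₁) z₂ + z₁ := by
    apply R.F_inj
    rw [map_add, map_add, map_smul, R.F_comm, hz₁, hz₂, hz₃, map_smul, ← smul_add, ← smul_add,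
      permRep_mul]
    congr 1
    have h2 : permRep ℤ Y (β g₁) e₀ - e₀ = R.F v + (2 : ℤ) • r₀ := he₀
    have h3 := congrArg (permRep ℤ Y (β g₁)) h2
    rw [map_sub, ← permRep_mul, ← pow_two, hg₁, map_one, map_one, Module.End.one_apply, map_add,
      map_smul, ← R.F_comm, hsq] at h3
    rw [map_sub, map_sub]
    refine smul_right_injective (Y → ℤ) (two_ne_zero (α := ℤ)) ?_
    simp only [smul_add, smul_sub, smul_neg]
    linear_combination (exp := 1) h2 + h3
  have hfinal : d ∣ m := by
    refine cancel (x := x₁) ?_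
    have e1 := congrFun hrel (α g₁ x₁)
    simp only [Pi.add_apply, permRep_apply_apply, Pi.smul_apply, smul_eq_mul] at e1
    have c1 := hs₁ (α g₁ x₁)
    have c2 := hs₂ x₁
    have c3 := hs₃ (α g₁ x₁)
    rw [R.mu_apply] at c1 c3
    have := (((((dvd_mul_right d (v (α g₁ x₁))).add c1).add c2).sub c3).add
      (((d₁.sub d₃).add d₂).mul_right (μ x₁)))
    exact this.trans (dvd_of_eq (by linear_combination -e1))
  have hm : m ≠ 0 := by
    rintro rfl
    exact R.d_ne (by simp [hd])
  rw [hd] at hfinal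
  have h2 : (2 : ℤ) ∣ 1 := by
    have : 2 * m ∣ 1 * m := by rwa [one_mul]
    exact (mul_dvd_mul_iff_right hm).1 this
  norm_num at h2

end PermResolution

/-! ### From the lattice `L_ν` to a resolution -/

theorem IsPermutationLattice.exists_equiv {Γ M : Type*} [Group Γ] [AddCommGroup M]
    {ρ : Representation ℤ Γ M} (h : IsPermutationLattice ρ) :
    ∃ (k : ℕ) (γ : Γ →* Equiv.Perm (Fin k)) (E : M ≃ₗ[ℤ] (Fin k → ℤ)),
      ∀ g x, E (ρ g x) = permRep ℤ (Fin k) (γ g) (E x) := by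
  obtain ⟨k, b, hb⟩ := h
  choose a ha using hb
  let γ : Γ →* Equiv.Perm (Fin k) := MonoidHom.toHomPerm
    { toFun := fun g => (a g : Function.End (Fin k))
      map_one' := by
        funext i
        apply b.injective
        rw [← ha, map_one]
        rfl
      map_mul' := fun g g' => by
        funext i
        apply b.injective
        change b (a (g * g') i) = b (a g (a g' i))
        rw [← ha, ← ha, ← ha, map_mul]
        rfl }
  refine ⟨k, γ, b.equivFun, fun g x => ?_⟩
  have : b.equivFun.toLinearMap ∘ₗ ρ g = permRep ℤ (Fin k) (γ g) ∘ₗ b.equivFun.toLinearMap := by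
    refine b.ext fun i => ?_
    have h1 (j : Fin k) : b.equivFun (b j) = Pi.single j 1 := by
      ext l
      rw [Module.Basis.equivFun_self, Pi.single_apply]
      simp [eq_comm]
    simp only [LinearMap.comp_apply, LinearEquiv.coe_coe, ha, h1, permRep_single]
    rfl
  exact LinearMap.congr_fun this x

namespace TypeA

variable {r : ℕ} {n : Fin r → ℕ}

theorem mem_nuLattice_iff (hn : ∀ i, 0 < n i) {d : ℕ} (hd : 0 < d) (hdn : ∀ i, d ∣ n i)
    (ν : Fin r → ℤ) (x : Ambient n) :
    x ∈ nuLattice n d ν ↔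
      (∀ i, ∑ j, x i j = 0) ∧ ∃ t : ℤ, ∀ i j, ∃ a : ℤ, x i j = t * ν i / d + a := by
  have hd' : (d : ℚ) ≠ 0 := by exact_mod_cast hd.ne'
  have hnu (i : Fin r) (j : Fin (n i)) : ∃ a : ℤ, (nuVector n d ν : Ambient n) i j =
      a - ν i / d := by
    have h1 : (n i : ℚ) ≠ 0 := by exact_mod_cast (hn i).ne'
    refine ⟨ν i * ((n i / d : ℕ) : ℤ) * (if (j : ℕ) = 0 then 1 else 0), ?_⟩
    change (ν i * ((n i / d : ℕ) : ℤ)) • omega (n i) j = _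
    obtain ⟨q, hq⟩ := hdn i
    have h2 : (n i : ℚ) = d * q := by exact_mod_cast hq
    have h3 : n i / d = q := by rw [hq, Nat.mul_div_cancel_left _ hd]
    have hq0 : (q : ℚ) ≠ 0 := by
      rintro h
      exact h1 (by rw [h2, h, mul_zero])
    rw [omega, zsmul_eq_mul, h3, h2]
    push_cast
    field_simp
  have hmem : x ∈ nuLattice n d ν ↔ ∃ (_ : x ∈ prodWeightLattice n) (k : ℤ),
      x - k • (nuVector n d ν : Ambient n) ∈ prodRootLattice n := by
    constructor
    · rintro ⟨y, hy, rfl⟩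
      obtain ⟨k, hk⟩ := Submodule.mem_span_singleton.1 hy
      refine ⟨y.2, k, ?_⟩
      rw [← Submodule.Quotient.mk_smul] at hk
      exact (Submodule.Quotient.eq ((prodRootLattice n).submoduleOf (prodWeightLattice n))).1 hk.symm
    · rintro ⟨hx, k, hk⟩
      refine ⟨⟨x, hx⟩, Submodule.mem_span_singleton.2 ⟨k, ?_⟩, rfl⟩
      rw [← Submodule.Quotient.mk_smul]
      exact ((Submodule.Quotient.eq
        ((prodRootLattice n).submoduleOf (prodWeightLattice n)) (x := ⟨x, hx⟩)).2 hk).symm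
  have hsum (i : Fin r) : ∑ j, (nuVector n d ν : Ambient n) i j = 0 :=
    ((nuVector n d ν).2 i trivial).1
  rw [hmem]
  constructor
  · rintro ⟨hx, k, hk⟩
    refine ⟨fun i => (hx i trivial).1, -k, fun i j => ?_⟩
    obtain ⟨a, ha⟩ := (hk i trivial).2 j
    obtain ⟨a', ha'⟩ := hnu i j
    refine ⟨a + k * a', ?_⟩
    rw [Pi.sub_apply, Pi.sub_apply, Pi.smul_apply, Pi.smul_apply, ha', zsmul_eq_mul] at ha
    push_cast
    linear_combination ha
  · rintro ⟨h0, t, ht⟩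
    refine ⟨fun i _ => ⟨h0 i, fun j k => ?_⟩, -t, fun i _ => ⟨?_, fun j => ?_⟩⟩
    · obtain ⟨a, ha⟩ := ht i j
      obtain ⟨a', ha'⟩ := ht i k
      exact ⟨a - a', by rw [ha, ha']; push_cast; ring⟩
    · simp only [Pi.sub_apply, Pi.smul_apply, Finset.sum_sub_distrib, h0 i, ← Finset.smul_sum,
        hsum i, smul_zero, sub_zero]
    · obtain ⟨a, ha⟩ := ht i j
      obtain ⟨a', ha'⟩ := hnu i j
      refine ⟨a + t * a', ?_⟩
      rw [Pi.sub_apply, Pi.sub_apply, Pi.smul_apply, Pi.smul_apply, ha', ha, zsmul_eq_mul]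
      push_cast
      ring

variable (n) in
/-- The index set of the coordinates of `⨁ ℚ^{n_i}`. -/
abbrev Coord : Type := Σ i, Fin (n i)

variable (n) in
/-- The action of `W` on the coordinates. -/
abbrev coordPerm : WeylGroup n →* Equiv.Perm (Coord n) :=
  Equiv.Perm.sigmaCongrRightHom fun i => Fin (n i)

variable (n) in
/-- The inclusion of `⨁ ℤ^{n_i}` into `⨁ ℚ^{n_i}`. -/
def toAmbient : (Coord n → ℤ) →ₗ[ℤ] Ambient n where
  toFun v i j := v ⟨i, j⟩
  map_add' _ _ := by ext; simp
  map_smul' _ _ := by ext; simp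

theorem toAmbient_injective : Function.Injective (toAmbient n) := by
  intro v w h
  ext ⟨i, j⟩
  have : ((v ⟨i, j⟩ : ℤ) : ℚ) = w ⟨i, j⟩ := congrFun (congrFun h i) j
  exact_mod_cast this

/-- The sum of the coordinates in the `i`-th block. -/
def blockSum (i : Fin r) : (Coord n → ℤ) →ₗ[ℤ] ℤ where
  toFun v := ∑ j, v ⟨i, j⟩
  map_add' _ _ := Finset.sum_add_distrib
  map_smul' _ _ := by simp [Finset.mul_sum]

theorem blockSum_permRep (w : WeylGroup n) (i : Fin r) (v : Coord n → ℤ) :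
    blockSum i (permRep ℤ _ (coordPerm n w) v) = blockSum i v :=
  Equiv.sum_comp (w i)⁻¹ fun j => v ⟨i, j⟩

/-- The first basis vector of the `i`-th block. -/
def baseVec (hn : ∀ i, 0 < n i) (i : Fin r) : Coord n → ℤ :=
  Pi.single ⟨i, ⟨0, hn i⟩⟩ 1

theorem blockSum_baseVec (hn : ∀ i, 0 < n i) (i k : Fin r) :
    blockSum i (baseVec hn k) = if i = k then 1 else 0 := by
  rcases eq_or_ne i k with rfl | h
  · change ∑ j, baseVec hn i ⟨i, j⟩ = _
    rw [Finset.sum_eq_single (⟨0, hn i⟩ : Fin (n i))]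
    · simp [baseVec]
    · intro j _ hj
      simp [baseVec, hj]
    · simp
  · rw [if_neg h]
    change ∑ j, baseVec hn k ⟨i, j⟩ = 0
    refine Finset.sum_eq_zero fun j _ => ?_
    simp [baseVec, h]

/-- The projection of `⨁ ℤ^{n_i}` onto the root lattice along the first basis vectors of the
blocks. -/
def rootProj (hn : ∀ i, 0 < n i) : (Coord n → ℤ) →ₗ[ℤ] (Coord n → ℤ) :=
  LinearMap.id - ∑ i, (blockSum i).smulRight (baseVec hn i)

theorem rootProj_apply (hn : ∀ i, 0 < n i) (v : Coord n → ℤ) :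
    rootProj hn v = v - ∑ i, blockSum i v • baseVec hn i := by
  simp [rootProj, LinearMap.sum_apply]

theorem rootProj_of_blockSum_eq_zero (hn : ∀ i, 0 < n i) {v : Coord n → ℤ}
    (hv : ∀ i, blockSum i v = 0) : rootProj hn v = v := by
  simp [rootProj_apply, hv]

theorem blockSum_rootProj (hn : ∀ i, 0 < n i) (i : Fin r) (v : Coord n → ℤ) :
    blockSum i (rootProj hn v) = 0 := by
  simp [rootProj_apply, map_sum, blockSum_baseVec, -zsmul_eq_mul]

theorem sum_toAmbient (i : Fin r) (v : Coord n → ℤ) :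
    ∑ j, toAmbient n v i j = (blockSum i v : ℤ) := by
  simp [toAmbient, blockSum]

/-- If `L_ν` is quasi-permutation, so is the lattice spanned by `⨁ ℤ^{n_i}` and the vector with
all coordinates in the `i`-th block equal to `ν i / d`. Indeed it is an extension of a trivial
lattice by `L_ν`, and `H¹` of `W` with values in a permutation lattice vanishes. -/
theorem exists_permResolution (hn : ∀ i, 0 < n i) {d : ℕ} (hd : 0 < d) (hdn : ∀ i, d ∣ n i)
    {ν : Fin r → ℤ} (hν : ∀ i, IsCoprime (ν i) (d : ℤ))
    (h : IsQuasiPermutationLattice (nuLatticeRep n d ν)) :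
    ∃ (k k' : ℕ) (β : WeylGroup n →* Equiv.Perm (Fin k ⊕ Fin r))
      (β' : WeylGroup n →* Equiv.Perm (Fin k')),
      Nonempty (PermResolution (d : ℤ) (fun x : Coord n => ν x.1) (coordPerm n) β β') := by
  obtain ⟨P, P', _, _, ρ, ρ', f₀, g₀, hρ, hρ', hf₀, hfg₀, hg₀⟩ := h
  obtain ⟨k, γ, E, hE⟩ := hρ.exists_equiv
  obtain ⟨k', γ', E', hE'⟩ := hρ'.exists_equiv
  have hd0 : (d : ℤ) ≠ 0 := by exact_mod_cast hd.ne'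
  have hdq : (d : ℚ) ≠ 0 := by exact_mod_cast hd.ne'
  -- The given sequence in coordinates.
  let f : nuLattice n d ν →ₗ[ℤ] (Fin k → ℤ) := E.toLinearMap ∘ₗ f₀.toLinearMap
  let g : (Fin k → ℤ) →ₗ[ℤ] (Fin k' → ℤ) :=
    E'.toLinearMap ∘ₗ g₀.toLinearMap ∘ₗ E.symm.toLinearMap
  have hf_inj : Function.Injective f := E.injective.comp hf₀
  have hg_surj : Function.Surjective g := E'.surjective.comp (hg₀.comp E.symm.surjective)
  have hgf (l) : g (f l) = 0 := by
    change E' (g₀.toLinearMap (E.symm (E (f₀.toLinearMap l)))) = 0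
    rw [E.symm_apply_apply, hfg₀.apply_apply_eq_zero, map_zero]
  have hexact (x) (hx : g x = 0) : ∃ l, f l = x := by
    have h1 : g₀.toLinearMap (E.symm x) = 0 := E'.injective (hx.trans (map_zero E').symm)
    obtain ⟨l, hl⟩ := (hfg₀ _).1 h1
    exact ⟨l, by change E (f₀.toLinearMap l) = x; rw [hl, E.apply_symm_apply]⟩
  have hf_comm (w) (l) : f (nuLatticeRep n d ν w l) = permRep ℤ _ (γ w) (f l) := by
    change E (f₀.toLinearMap _) = permRep ℤ _ (γ w) (E (f₀.toLinearMap l))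
    rw [← hE]
    exact congrArg E (LinearMap.congr_fun (f₀.isIntertwining' w) l)
  have hg_comm (w) (x) : g (permRep ℤ _ (γ w) x) = permRep ℤ _ (γ' w) (g x) := by
    obtain ⟨x, rfl⟩ := E.surjective x
    change E' (g₀.toLinearMap (E.symm _)) =
      permRep ℤ _ (γ' w) (E' (g₀.toLinearMap (E.symm (E x))))
    rw [← hE, ← hE', E.symm_apply_apply, E.symm_apply_apply]
    exact congrArg E' (LinearMap.congr_fun (g₀.isIntertwining' w) x)
  -- The root lattice as a sublattice of `L_ν`.
  let j : (Coord n → ℤ) →ₗ[ℤ] nuLattice n d ν :=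
    (toAmbient n ∘ₗ rootProj hn).codRestrict _ fun v => by
      refine (mem_nuLattice_iff hn hd hdn ν _).2 ⟨fun i => ?_, 0, fun i l =>
        ⟨rootProj hn v ⟨i, l⟩, by simp [toAmbient]⟩⟩
      rw [LinearMap.comp_apply, sum_toAmbient, blockSum_rootProj, Int.cast_zero]
  have hj_val (v) : (j v : Ambient n) = toAmbient n (rootProj hn v) := rfl
  have hj_base (i) : j (baseVec hn i) = 0 := by
    apply Subtype.ext
    rw [hj_val, rootProj_apply]
    simp [blockSum_baseVec]
  let α := coordPerm n
  have hbs0 (w : WeylGroup n) (i l : Fin r) :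
      blockSum l (permRep ℤ _ (α w) (baseVec hn i) - baseVec hn i) = 0 := by
    rw [map_sub, blockSum_permRep, sub_self]
  have hj_comm (w) (v) : j (permRep ℤ _ (α w) v) = nuLatticeRep n d ν w (j v) +
      ∑ i, blockSum i v • j (permRep ℤ _ (α w) (baseVec hn i) - baseVec hn i) := by
    apply Subtype.ext
    have h1 : (nuLatticeRep n d ν w (j v) : Ambient n) =
      toAmbient n (permRep ℤ _ (α w) (rootProj hn v)) := rfl
    rw [Submodule.coe_add, h1, Submodule.coe_sum]
    simp only [hj_val, ← map_smul, ← map_sum, ← map_add]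
    congr 1
    simp only [map_sum, map_smul, rootProj_of_blockSum_eq_zero hn (hbs0 w _)]
    rw [rootProj_apply, rootProj_apply]
    simp only [blockSum_permRep, α, map_sub, map_sum, map_smul, smul_sub, Finset.sum_sub_distrib]
    abel
  have hj_comm0 (w) (v) (hv : ∀ i, blockSum i v = 0) :
      j (permRep ℤ _ (α w) v) = nuLatticeRep n d ν w (j v) := by
    rw [hj_comm]
    simp [hv]
  -- Extension of `f` from the root lattice to `⨁ ℤ^{n_i}`.
  have hcoc (i : Fin r) : ∃ y : Fin k → ℤ, ∀ w,
      f (j (permRep ℤ _ (α w) (baseVec hn i) - baseVec hn i)) = permRep ℤ _ (γ w) y - y := by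
    refine exists_eq_permRep_sub γ _ fun w w' => ?_
    rw [← hf_comm, ← hj_comm0 w _ (hbs0 w' i), ← map_add, ← map_add]
    congr 2
    rw [map_sub (permRep ℤ _ (α w)), PermResolution.permRep_mul]
    abel
  choose y hy using hcoc
  let F₁ : (Coord n → ℤ) →ₗ[ℤ] (Fin k → ℤ) := f ∘ₗ j + ∑ i, (blockSum i).smulRight (y i)
  have hF₁ (v) : F₁ v = f (j v) + ∑ i, blockSum i v • y i := by
    simp [F₁, LinearMap.sum_apply]
  have hF₁_comm (w) (v) : F₁ (permRep ℤ _ (α w) v) = permRep ℤ _ (γ w) (F₁ v) := by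
    rw [hF₁, hF₁, hj_comm]
    simp only [map_add, map_sum, map_smul, hf_comm, hy, blockSum_permRep, α, smul_sub,
      Finset.sum_sub_distrib]
    abel
  let F : (Coord n → ℤ) →ₗ[ℤ] (Fin k ⊕ Fin r → ℤ) :=
    { toFun := fun v => Sum.elim (F₁ v) fun i => blockSum i v
      map_add' := fun v w => by ext (i | i) <;> simp
      map_smul' := fun c v => by ext (i | i) <;> simp [-zsmul_eq_mul] }
  let H : (Fin k ⊕ Fin r → ℤ) →ₗ[ℤ] (Fin k → ℤ) :=
    LinearMap.funLeft ℤ ℤ Sum.inl - ∑ i, (LinearMap.proj (Sum.inr i)).smulRight (y i)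
  have hH (e) : H e = e ∘ Sum.inl - ∑ i, e (Sum.inr i) • y i := by
    simp only [H, LinearMap.sub_apply, LinearMap.sum_apply, LinearMap.smulRight_apply,
      LinearMap.proj_apply]
    rfl
  let β : WeylGroup n →* Equiv.Perm (Fin k ⊕ Fin r) :=
    (Equiv.Perm.sumCongrHom (Fin k) (Fin r)).comp (γ.prod 1)
  have hβ (w) (e : Fin k ⊕ Fin r → ℤ) : permRep ℤ _ (β w) e =
      Sum.elim (permRep ℤ _ (γ w) (e ∘ Sum.inl)) (e ∘ Sum.inr) := by
    ext (i | i) <;> rfl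
  refine ⟨k, k', β, γ', ⟨
    { F := F
      G := g ∘ₗ H
      d_ne := hd0
      mu_apply := fun w x => rfl
      isCoprime := fun x => hν x.1
      F_comm := fun w v => ?_
      G_comm := fun w e => ?_
      F_inj := ?_
      G_surj := ?_
      exists_of_mem := ?_
      exists_of_G_eq_zero := ?_ }⟩⟩
  · rw [hβ]
    change Sum.elim _ _ = Sum.elim (permRep ℤ _ (γ w) (F₁ v)) fun i => blockSum i v
    rw [← hF₁_comm]
    simp only [blockSum_permRep]
    rfl
  · rw [LinearMap.comp_apply g H, LinearMap.comp_apply g H, ← hg_comm, ← sub_eq_zero, ← map_sub]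
    have : H (permRep ℤ _ (β w) e) - permRep ℤ _ (γ w) (H e) =
        f (∑ i, e (Sum.inr i) • j (permRep ℤ _ (α w) (baseVec hn i) - baseVec hn i)) := by
      rw [hH, hH, hβ]
      simp only [map_sum, map_smul, hy]
      simp only [map_sum, map_smul, map_sub, smul_sub, Finset.sum_sub_distrib, Sum.elim_comp_inl, Sum.elim_inr, Function.comp_apply]
      abel
    rw [this, hgf]
  · rw [injective_iff_map_eq_zero]
    intro v hv
    have hbs (i) : blockSum i v = 0 := congrFun hv (Sum.inr i)
    have h1 : F₁ v = 0 := funext fun i => congrFun hv (Sum.inl i)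
    rw [hF₁] at h1
    simp only [hbs, zero_smul, Finset.sum_const_zero, add_zero] at h1
    have h2 : j v = 0 := hf_inj (h1.trans (map_zero f).symm)
    have h3 := congrArg Subtype.val h2
    rw [hj_val, rootProj_of_blockSum_eq_zero hn hbs] at h3
    exact toAmbient_injective (h3.trans (map_zero _).symm)
  · refine hg_surj.comp fun x => ⟨Sum.elim x 0, ?_⟩
    rw [hH]
    simp
  · rintro z ⟨t, ht⟩
    have hq (i) : (d : ℤ) ∣ blockSum i z := by
      change (d : ℤ) ∣ ∑ l, z ⟨i, l⟩
      have h1 : (d : ℤ) ∣ ∑ l : Fin (n i), t * ν i := by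
        rw [Finset.sum_const, Finset.card_univ, Fintype.card_fin, nsmul_eq_mul]
        exact (Int.natCast_dvd_natCast.2 (hdn i)).mul_right _
      have h2 : (d : ℤ) ∣ ∑ l : Fin (n i), (z ⟨i, l⟩ - t * ν i) :=
        Finset.dvd_sum fun l _ => ht ⟨i, l⟩
      simpa [← Finset.sum_add_distrib] using dvd_add h2 h1
    choose q hq using hq
    choose a ha using ht
    let l : nuLattice n d ν := ⟨(d : ℚ)⁻¹ • toAmbient n (rootProj hn z), by
      refine (mem_nuLattice_iff hn hd hdn ν _).2 ⟨fun i => ?_, t, fun i l =>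
        ⟨a ⟨i, l⟩ - ∑ i', q i' * baseVec hn i' ⟨i, l⟩, ?_⟩⟩
      · simp only [Pi.smul_apply, ← Finset.smul_sum, sum_toAmbient, blockSum_rootProj,
          Int.cast_zero, smul_zero]
      · have h1 : rootProj hn z ⟨i, l⟩ =
            t * ν i + d * (a ⟨i, l⟩ - ∑ i', q i' * baseVec hn i' ⟨i, l⟩) := by
          rw [rootProj_apply, Pi.sub_apply, Finset.sum_apply, mul_sub, ← ha, Finset.mul_sum]
          simp only [hq, Pi.smul_apply, smul_eq_mul, mul_assoc]
          ring
        change (d : ℚ)⁻¹ * ((rootProj hn z ⟨i, l⟩ : ℤ) : ℚ) = _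
        rw [h1]
        push_cast
        field_simp⟩
    have hl : j z = (d : ℤ) • l := by
      apply Subtype.ext
      ext i s
      change toAmbient n (rootProj hn z) i s =
        (d : ℤ) • ((d : ℚ)⁻¹ * toAmbient n (rootProj hn z) i s)
      rw [zsmul_eq_mul, Int.cast_natCast, mul_inv_cancel_left₀ hdq]
    refine ⟨Sum.elim (f l + ∑ i, q i • y i) q, ?_, ?_⟩
    · change Sum.elim (F₁ z) _ = _
      rw [hF₁, hl]
      simp only [hq, map_smul]
      ext (i | i)
      · simp [mul_add, Finset.mul_sum, mul_assoc]
      · simp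
    · rw [LinearMap.comp_apply, hH]
      simp [hgf]
  · intro e he
    obtain ⟨l, hl⟩ := hexact _ he
    obtain ⟨h0, t, ht⟩ := (mem_nuLattice_iff hn hd hdn ν l).1 l.2
    choose a ha using ht
    let z₀ : Coord n → ℤ := fun x => t * ν x.1 + d * a x.1 x.2
    have hz₀ : toAmbient n z₀ = (d : ℤ) • (l : Ambient n) := by
      ext i s
      change ((t * ν i + d * a i s : ℤ) : ℚ) = (d : ℤ) • (l : Ambient n) i s
      rw [ha i s, zsmul_eq_mul]
      push_cast
      field_simp
    have hbs (i) : blockSum i z₀ = 0 := by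
      have h1 := sum_toAmbient i z₀
      rw [hz₀] at h1
      simp only [Pi.smul_apply, ← Finset.smul_sum, h0 i, smul_zero] at h1
      exact_mod_cast h1.symm
    have hjz₀ : j z₀ = (d : ℤ) • l := by
      apply Subtype.ext
      rw [hj_val, rootProj_of_blockSum_eq_zero hn hbs, hz₀]
      rfl
    let z := z₀ + (d : ℤ) • ∑ i, e (Sum.inr i) • baseVec hn i
    have hbsz (i) : blockSum i z = d * e (Sum.inr i) := by
      simp only [z, map_add, map_smul, map_sum, hbs, blockSum_baseVec, zero_add, smul_eq_mul,
        mul_ite, mul_one, mul_zero, Finset.sum_ite_eq, Finset.mem_univ, if_true]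
    have hjz : j z = (d : ℤ) • l := by
      simp only [z, map_add, map_smul, map_sum, hjz₀, hj_base, smul_zero, Finset.sum_const_zero,
        add_zero]
    refine ⟨z, ⟨t, fun x => ?_⟩, ?_⟩
    · have : z x - t * ν x.1 =
          d * (a x.1 x.2 + (∑ i, e (Sum.inr i) • baseVec hn i) x) := by
        simp only [z, z₀, Pi.add_apply, Pi.smul_apply, smul_eq_mul]
        ring
      rw [this]
      exact dvd_mul_right _ _
    · change Sum.elim (F₁ z) _ = _
      rw [hF₁, hjz, map_smul, hl, hH]
      ext (i | i)
      · simp only [hbsz, Sum.elim_inl, Pi.add_apply, Pi.smul_apply, Pi.sub_apply, smul_eq_mul,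
          Finset.sum_apply, Function.comp_apply, mul_sub, Finset.mul_sum, mul_assoc]
        ring
      · simp [hbsz]

end TypeA

namespace TypeA

variable {r : ℕ} {n : Fin r → ℕ}

/-! ### Elements of the Weyl group -/

/-- If `p` divides all `n i`, the coordinates can be divided into sets of `p` elements, indexed
by `B` and identified with `ℤ/p`, in such a way that permutations of these sets belong to `W`. -/
theorem exists_blocks {p : ℕ} [NeZero p] (hpn : ∀ i, p ∣ n i) :
    ∃ (B : Type) (_ : Fintype B) (pt : B → ZMod p → Coord n)
      (T : (B → Equiv.Perm (ZMod p)) →* WeylGroup n),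
      Fintype.card B * p = ∑ i, n i ∧ (∀ x, ∃ b s, pt b s = x) ∧
      (∀ b, Function.Injective (pt b)) ∧
      ∀ c b s, coordPerm n (T c) (pt b s) = pt b (c b s) := by
  choose m hm using hpn
  have e (i : Fin r) : Fin (n i) ≃ Fin (m i) × ZMod p :=
    Fintype.equivOfCardEq (by simp [hm, ZMod.card, mul_comm])
  let T : ((Σ i, Fin (m i)) → Equiv.Perm (ZMod p)) →* WeylGroup n :=
    { toFun := fun c i => (e i).trans
        ((Equiv.prodCongrRight fun a => c ⟨i, a⟩).trans (e i).symm)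
      map_one' := by
        funext i
        ext j
        simp [Equiv.prodCongrRight]
      map_mul' := fun c c' => by
        funext i
        ext j
        simp [Equiv.prodCongrRight] }
  refine ⟨Σ i, Fin (m i), inferInstance, fun b s => ⟨b.1, (e b.1).symm (b.2, s)⟩, T, ?_, ?_, ?_, ?_⟩
  · simp [hm, Finset.mul_sum, mul_comm]
  · rintro ⟨i, j⟩
    exact ⟨⟨i, (e i j).1⟩, (e i j).2, by simp⟩
  · intro b s s' h
    simpa using h
  · rintro c ⟨i, a⟩ s
    change (⟨i, _⟩ : Coord n) = ⟨i, _⟩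
    simp [T, Equiv.prodCongrRight]

theorem addLeft_one_pow_apply (p k : ℕ) (s : ZMod p) :
    (Equiv.addLeft (1 : ZMod p) ^ k) s = k + s := by
  induction k with
  | zero => simp
  | succ k ih =>
    rw [pow_succ', Equiv.Perm.mul_apply, ih, Equiv.coe_addLeft]
    push_cast
    ring

theorem addLeft_one_pow (p : ℕ) : Equiv.addLeft (1 : ZMod p) ^ p = 1 :=
  Equiv.ext fun s => by rw [addLeft_one_pow_apply, ZMod.natCast_self, zero_add]; rfl

end TypeA

open TypeA in
theorem proposition3p2 {r : ℕ} (hr : 0 < r) (n : Fin r → ℕ) (hn : ∀ i, 0 < n i)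
    (d : ℕ) (hd : 1 < d) (hdn : d ∣ Finset.univ.gcd n)
    (ν : Fin r → ℤ) (hν : ∀ i, 1 ≤ ν i ∧ ν i < d ∧ IsCoprime (ν i) (d : ℤ))
    (hν1 : ν ⟨0, hr⟩ = 1)
    (hsum : (∃ s : ℕ, d = 2 ^ s) → 4 < ∑ i, n i)
    (hsum3 : ∑ i, n i ≠ 3) :
    ¬ IsQuasiPermutationLattice (TypeA.nuLatticeRep n d ν) := by
  intro h
  have hdn' (i) : d ∣ n i := hdn.trans (Finset.gcd_dvd (Finset.mem_univ i))
  obtain ⟨k, k', β, β', ⟨R⟩⟩ := exists_permResolution hn (by omega) hdn' (fun i => (hν i).2.2) h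
  have hpos : 0 < ∑ i, n i :=
    Finset.sum_pos (fun i _ => hn i) ⟨⟨0, hr⟩, Finset.mem_univ _⟩
  by_cases h5 : ∃ p, p.Prime ∧ p ∣ d ∧ 5 ≤ p
  · -- The affine group of `ℤ/p`, acting simultaneously on all blocks.
    obtain ⟨p, hp, ⟨m, rfl⟩, hp5⟩ := h5
    have : Fact p.Prime := ⟨hp⟩
    obtain ⟨B, _, pt, T, -, hsurj, hinj, hT⟩ :=
      exists_blocks (n := n) (p := p) fun i => (Dvd.intro _ rfl).trans (hdn' i)
    have cast_ne {a : ℕ} (ha0 : 0 < a) (ha : a < p) : (a : ZMod p) ≠ 0 := fun h =>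
      absurd (Nat.le_of_dvd ha0 ((ZMod.natCast_eq_zero_iff a p).1 h)) (by omega)
    have h2 : (2 : ZMod p) ≠ 0 := by exact_mod_cast cast_ne (a := 2) (by omega) (by omega)
    have h3 : (3 : ZMod p) ≠ 0 := by exact_mod_cast cast_ne (a := 3) (by omega) (by omega)
    have : Nonempty (Coord n) := ⟨⟨⟨0, hr⟩, ⟨0, hn _⟩⟩⟩
    let σ := T fun _ => Equiv.addLeft 1
    let τ := T fun _ => Equiv.mulLeft₀ (2 : ZMod p) h2
    have hkcast : (((2 : ZMod p)⁻¹.val : ℕ) : ZMod p) = 2⁻¹ := ZMod.natCast_zmod_val _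
    refine R.false_of_character (σ := σ) (τ := τ) (k := (2 : ZMod p)⁻¹.val) (l := 2) (m := m) hp
      (by push_cast; rfl) ?_ ?_ ?_ ?_ ?_
    · rw [← map_pow, ← map_one T]
      congr 1
      funext b
      exact addLeft_one_pow p
    · intro x hx
      obtain ⟨b, s, rfl⟩ := hsurj x
      rw [hT] at hx
      simpa using hinj b hx
    · rw [← map_pow, ← map_mul, ← map_mul]
      congr 1
      funext b
      simp only [Pi.mul_apply, Pi.pow_apply]
      ext s
      simp only [Equiv.Perm.mul_apply, Equiv.coe_addLeft, Equiv.mulLeft₀_apply,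
        addLeft_one_pow_apply, hkcast]
      field_simp
    · rw [← map_pow, ← map_inv, ← map_mul, ← map_mul]
      congr 1
      funext b
      simp only [Pi.mul_apply, Pi.pow_apply, Pi.inv_apply]
      ext s
      simp only [Equiv.Perm.mul_apply, Equiv.coe_addLeft, Equiv.Perm.inv_def,
        Equiv.mulLeft₀_symm_apply, addLeft_one_pow_apply]
      field_simp
      push_cast
      rfl
    · rw [hkcast]
      intro h
      apply h3
      have : (2 : ZMod p)⁻¹ * 2 = 4 := by rw [h]; push_cast; norm_num
      rw [inv_mul_cancel₀ h2] at this
      linear_combination -this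
  by_cases h3 : 3 ∣ d
  · -- `σ` rotates all triples, and `π` rotates a single one.
    obtain ⟨m, rfl⟩ := h3
    obtain ⟨B, _, pt, T, hcard, hsurj, hinj, hT⟩ :=
      exists_blocks (n := n) (p := 3) fun i => (Dvd.intro _ rfl).trans (hdn' i)
    obtain ⟨b₀, b₁, hb⟩ : ∃ b₀ b₁ : B, b₀ ≠ b₁ := by
      have : 1 < Fintype.card B := by omega
      exact Fintype.exists_pair_of_one_lt_card this
    classical
    let σ := T fun _ => Equiv.addLeft 1
    let π := T fun b => if b = b₁ then Equiv.addLeft 1 else 1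
    refine R.false_of_bicyclic (σ := σ) (π := π) (m := m) (p := 3) Nat.prime_three (by decide)
      (by push_cast; rfl) ?_ ?_ ?_ ?_ (x₁ := pt b₀ 0) (x₂ := pt b₁ 0) ?_ ?_
    · rw [← map_pow, ← map_one T]
      congr 1
      funext b
      exact addLeft_one_pow 3
    · intro x hx
      obtain ⟨b, s, rfl⟩ := hsurj x
      rw [hT] at hx
      simpa using hinj b hx
    · rw [← map_pow, ← map_one T]
      congr 1
      funext b
      rw [Pi.pow_apply, Pi.one_apply]
      split_ifs
      · exact addLeft_one_pow 3
      · exact one_pow 3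
    · refine Commute.map (f := T) ?_
      refine Pi.commute_iff.2 fun b => ?_
      split_ifs
      · exact Commute.refl _
      · exact Commute.one_right _
    · rw [hT, if_neg hb]
      rfl
    · rw [hT, hT, if_pos rfl]
  · -- Only `2` is left. The involutions `g₁` and `g₂` swap all pairs except one each.
    have hpow : ∃ s : ℕ, d = 2 ^ s := by
      refine ⟨d.primeFactorsList.length, Nat.eq_prime_pow_of_unique_prime_dvd (by omega) ?_⟩
      intro q hq hqd
      by_contra hq2
      rcases hq.eq_two_or_odd with h | hodd
      · exact hq2 h
      have : q < 5 := by
        by_contra hq5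
        exact h5 ⟨q, hq, hqd, by omega⟩
      have : q = 3 := by
        have := hq.two_le
        omega
      exact h3 (this ▸ hqd)
    have h4 := hsum hpow
    obtain ⟨s, rfl⟩ := hpow
    have hs : s ≠ 0 := by
      rintro rfl
      simp at hd
    have h2d : 2 ∣ 2 ^ s := dvd_pow_self 2 hs
    obtain ⟨m, hm⟩ := h2d
    obtain ⟨B, _, pt, T, hcard, hsurj, hinj, hT⟩ :=
      exists_blocks (n := n) (p := 2) fun i => (Dvd.intro _ hm.symm).trans (hdn' i)
    obtain ⟨b₁, b₂, b₃, h12, h13, h23⟩ := Fintype.two_lt_card_iff.1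
      (show 2 < Fintype.card B by omega)
    classical
    let g (b' : B) := T fun b => if b = b' then 1 else Equiv.addLeft 1
    have hsq (b') : g b' ^ 2 = 1 := by
      rw [← map_pow, ← map_one T]
      congr 1
      funext b
      rw [Pi.pow_apply, Pi.one_apply]
      split_ifs
      · exact one_pow 2
      · exact addLeft_one_pow 2
    have hfix {b' b : B} {s : ZMod 2} (h : coordPerm n (g b') (pt b s) = pt b s) : b = b' := by
      by_contra hb
      rw [hT, if_neg hb] at h
      simpa using hinj b h
    refine R.false_of_four_group (g₁ := g b₁) (g₂ := g b₂) (m := m) (by rw [hm]; push_cast; rfl)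
      (hsq _) (hsq _) ?_ ?_ (x₁ := pt b₁ 0) (x₂ := pt b₂ 0) (x₃ := pt b₃ 0) ?_ ?_ ?_
    · refine Commute.map (f := T) ?_
      refine Pi.commute_iff.2 fun b => ?_
      split_ifs <;> simp
    · intro x h1 h2
      obtain ⟨b, s, rfl⟩ := hsurj x
      exact h12 ((hfix h1).symm.trans (hfix h2))
    · rw [hT, if_pos rfl]
      rfl
    · rw [hT, if_pos rfl]
      rfl
    · rw [hT, hT, if_neg h13.symm, if_neg h23.symm]
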